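/- For a finite field $\mathbb{F}_q$ with $q$ an odd prime power, let $G_0=\mathbb{F}_q^2\rtimes SO_2(\mathbb{F}_q)$ be the group of rigid motions of the plane $\mathbb{F}_q^2$, with group law $(z_1,h_1)(z_2,h_2)=(z_1+h_1z_2,\,h_1h_2)$ and action $(z,h)x=z+hx$ on $\mathbb{F}_q^2$, and let $\|x\|=x_1^2+x_2^2$ for $x\in\mathbb{F}_q^2$. For $E\subseteq\mathbb{F}_q^2$, $t\in\mathbb{F}_q^*$ and a fixed pair $(u_0,v_0)\in E\times E$ with $\|u_0-v_0\|=t$, let $X_t\subseteq G_0$ be the set of all rigid motions $g$ for which there is a pair $(x,y)\in E\times E$ with $\|x-y\|=t$, $gx=u_0$ and $gy=v_0$. Let $X_tX_t=\{gh: g,h\in X_t\}$. There is an absolute constant $c_0>0$ such that for every $\varepsilon>0$ there are $c_1=c_1(\varepsilon)>0$ and $q_0=q_0(\varepsilon)$ with the following property. Let $q$ be an odd prime power, let $E\subseteq \mathbb{F}_q^2$ with $|E|=q^\alpha$, where $\frac32+\varepsilon\le\alpha<2$, let $t\in\mathbb{F}_q^*$, and let $u_0,v_0\in E$ with $\|u_0-v_0\|=t$.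 Put $m(\alpha)=\min\{2-\alpha,\,2\alpha-3\}>0$ and $\delta(\alpha)=\dfrac{m(\alpha)}{2\alpha-1}>0$. Then $$|X_tX_t|\ \ge\ c\,|X_t|^{1+\delta(\alpha)},\qquad |X_tX_t|\ \ge\ c\,q^{m(\alpha)}\,|X_t|,\qquad |X_tX_t|\ \ge\ c\,\min\Big\{q|E|,\ \frac{|E|^4}{q^4}\Big\}$$ with some $c\ge c_1$, and if moreover $q\ge q_0$, with some $c\ge c_0$. -/

import Mathlib

open scoped Pointwise

/-- The special orthogonal group `SO₂(F)`: the `2 × 2` matrices `A` with `A Aᵀ = 1`, `det A = 1`. -/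
abbrev SO2 (F : Type*) [Field F] := Matrix.specialOrthogonalGroup (Fin 2) F

/-- `SO₂(F)` acts on the additive group `F²` by `φ_h(x) = h x`. (The additive group is written
multiplicatively through `Multiplicative`, as Mathlib's semidirect product is multiplicative.) -/
def SO2.toAut (F : Type*) [Field F] : SO2 F →* MulAut (Multiplicative (Fin 2 → F)) where
  toFun h :=
    { toFun := fun x => Multiplicative.ofAdd (Matrix.mulVec h.1 x.toAdd)
      invFun := fun x => Multiplicative.ofAdd (Matrix.mulVec (h⁻¹).1 x.toAdd)
      left_inv := fun x => by
        have e : (h⁻¹).1 * h.1 = 1 := congrArg Subtype.val (inv_mul_cancel h)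
        beta_reduce
        rw [toAdd_ofAdd, Matrix.mulVec_mulVec, e, Matrix.one_mulVec, ofAdd_toAdd]
      right_inv := fun x => by
        have e : h.1 * (h⁻¹).1 = 1 := congrArg Subtype.val (mul_inv_cancel h)
        beta_reduce
        rw [toAdd_ofAdd, Matrix.mulVec_mulVec, e, Matrix.one_mulVec, ofAdd_toAdd]
      map_mul' := fun x y => by
        rw [toAdd_mul, Matrix.mulVec_add, ofAdd_add] }
  map_one' := MulEquiv.ext fun x => congrArg Multiplicative.ofAdd (Matrix.one_mulVec x.toAdd)
  map_mul' h k := MulEquiv.ext fun x =>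
    congrArg Multiplicative.ofAdd (Matrix.mulVec_mulVec x.toAdd h.1 k.1).symm

/-- The group `G₀ = F² ⋊ SO₂(F)` of rigid motions of the plane `F²`, with the group law
`(z₁, h₁) (z₂, h₂) = (z₁ + h₁ z₂, h₁ h₂)`. -/
abbrev RigidMotion (F : Type*) [Field F] :=
  Multiplicative (Fin 2 → F) ⋊[SO2.toAut F] SO2 F

/-- The rigid motion `(z, h)` as an affine transformation of the plane: `(z, h) x = z + h x`. -/
def RigidMotion.apply {F : Type*} [Field F] (g : RigidMotion F) (x : Fin 2 → F) : Fin 2 → F :=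
  g.left.toAdd + Matrix.mulVec g.right.1 x

/-- `‖x‖ = x₁² + x₂²`, with values in `F`; `‖x - y‖` is the length of the segment `(x, y)`. -/
def planeNorm {F : Type*} [Field F] (x : Fin 2 → F) : F := x 0 ^ 2 + x 1 ^ 2

/-- The set `X_t` of all rigid motions that carry some segment `(x, y) ∈ E × E` of length `t` to
the segment `(u, v)`. -/
def segmentMotions {F : Type*} [Field F] (E : Finset (Fin 2 → F)) (t : F) (u v : Fin 2 → F) :
    Set (RigidMotion F) :=
  {g | ∃ x ∈ E, ∃ y ∈ E, planeNorm (x - y) = t ∧ g.apply x = u ∧ g.apply y = v}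

/-! Write N = |E| and X = X_t. A motion g in X is the same thing as the segment (g⁻¹u₀, g⁻¹v₀) of
length t in E, because SO₂ acts simply transitively on vectors of norm t ≠ 0; hence |X| is the
number of such segments, about N²/q.

Growth comes from an energy bound. By Cauchy–Schwarz |X|⁴ ≤ |XX| Σ ν(k)², where ν(k) counts the
pairs in X with g'⁻¹g = k. Such a k carries the point g⁻¹u₀ of E to the point g'⁻¹u₀ of E, so if
every x in E starts at most D segments, then ν(k) ≤ D i(k) with i(k) = #{x ∈ E : kx ∈ E}. Parseval
and the freeness of rotations on nonzero frequencies bound the total squared deviation of i from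
N²/q² by q²N² (`sum_motionDegree_sub_sq_le`).

To have D of order N/q, X is first trimmed to starting points of degree at most twice the mean. This
keeps a positive proportion of X, since circles have Fourier coefficients O(√q) away from 0 and so
degrees rarely deviate (`sum_circleDegree_sub_sq_le`). Then Σ ν² ≲ (N³/q³)|X|² + N⁴, which gives
|XX| ≳ min(qN, N⁴/q⁴); the two other bounds follow from |X| ≲ N²/q.

The circle estimate is Weil's bound for Kloosterman sums (`abs_kloostermanSum_re_le`), proved by
elementary means. Stepanov's method bounds from below the number of points of y^q - y = ax + b/x
over large extensions, which prevents Kloosterman sums there from being very negative. In a tower of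
quadratic extensions the normalized sums obey u ↦ 2 - u², which runs off to -∞ unless |u| ≤ 2 at the
start. -/

/-! ### Stepanov's method for values of a squarefree polynomial. -/

open Polynomial in
theorem Polynomial.expand_card_pow {F : Type*} [Field F] [Fintype F] (f : F[X]) (k : ℕ) :
    expand F (Fintype.card F ^ k) f = f ^ (Fintype.card F ^ k) := by
  induction k with
  | zero => simp
  | succ k ih => rw [pow_succ', expand_mul, ih, map_pow, FiniteField.expand_card, ← pow_mul]

open Polynomial in
/-- If `h` is squarefree of positive degree, then a constant multiple of `h` is not a square in
the field of rational functions. -/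
theorem Polynomial.eq_zero_of_sq_eq_squarefree_mul_sq {F : Type*} [Field F] {h : F[X]}
    (hsq : Squarefree h) (hdeg : 0 < h.natDegree) {c : F} (hc : c ≠ 0) {a b : F[X]}
    (hab : a ^ 2 = C c * h * b ^ 2) : b = 0 := by
  have h0 : h ≠ 0 := by rintro rfl; simp at hdeg
  induction hn : b.natDegree using Nat.strong_induction_on generalizing a b with
  | _ n ih =>
    by_contra hb
    -- Descent: squarefreeness makes h divide a and then b, and the quotients satisfy the same
    -- equation in smaller degree.
    have h1 : h ∣ a := (hsq.dvd_pow_iff_dvd two_ne_zero).1 ⟨C c * b ^ 2, by rw [hab]; ring⟩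
    obtain ⟨a₁, rfl⟩ := h1
    have e1 : h * a₁ ^ 2 = C c * b ^ 2 := mul_left_cancel₀ h0 (by linear_combination hab)
    have cc : C c⁻¹ * C c = (1 : F[X]) := by rw [← C_mul, inv_mul_cancel₀ hc, C_1]
    have h2 : h ∣ b := (hsq.dvd_pow_iff_dvd two_ne_zero).1
      ⟨C c⁻¹ * a₁ ^ 2, by linear_combination (-C c⁻¹) * e1 - b ^ 2 * cc⟩
    obtain ⟨b₁, rfl⟩ := h2
    have e2 : a₁ ^ 2 = C c * h * b₁ ^ 2 := mul_left_cancel₀ h0 (by linear_combination e1)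
    have hb₁ : b₁ ≠ 0 := by rintro rfl; simp at hb
    refine hb₁ (ih b₁.natDegree ?_ e2 rfl)
    rw [← hn, natDegree_mul h0 hb₁]
    omega

open Polynomial in
/-- The auxiliary polynomial of Stepanov's method does not vanish identically. -/
theorem Polynomial.stepanov_independence {F : Type*} [Field F] {h : F[X]}
    (hsq : Squarefree h) (hdeg : 0 < h.natDegree) (hc : h.coeff 0 ≠ 0) {r e : ℕ} (hr : r ≠ 0)
    (hh : h.natDegree ≤ 2 * e) (J : ℕ) (a b : ℕ → F[X])
    (ha : ∀ j, 2 * (a j).natDegree < r) (hb : ∀ j, b j ≠ 0 → 2 * ((b j).natDegree + e) < r)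
    (hab : (∑ j ∈ Finset.range J, a j * X ^ (r * j)) ^ 2
      = h * expand F r h * (∑ j ∈ Finset.range J, b j * X ^ (r * j)) ^ 2) :
    ∀ j < J, a j = 0 ∧ b j = 0 := by
  induction J generalizing a b with
  | zero => intro j hj; omega
  | succ J ih =>
    have split : ∀ f : ℕ → F[X], ∑ j ∈ Finset.range (J + 1), f j * X ^ (r * j)
        = f 0 + X ^ r * ∑ j ∈ Finset.range J, f (j + 1) * X ^ (r * j) := by
      intro f
      rw [Finset.sum_range_succ', Finset.mul_sum, add_comm]
      simp only [mul_zero, pow_zero, mul_one, mul_add, pow_add]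
      congr 1
      exact Finset.sum_congr rfl fun i _ => by ring
    rw [split, split] at hab
    obtain ⟨h₁, hh₁⟩ : X ^ r ∣ expand F r h - C (h.coeff 0) := by
      have : X ∣ h - C (h.coeff 0) := by rw [X_dvd_iff]; simp
      obtain ⟨g, hg⟩ := this
      refine ⟨expand F r g, ?_⟩
      have := congrArg (expand F r) hg
      simpa using this
    have hexp : expand F r h = C (h.coeff 0) + X ^ r * h₁ := by rw [← hh₁]; ring
    -- Modulo X^r only the terms j = 0 survive and h(X^r) becomes h(0). Both sides have degree below
    -- r, so the congruence is an equality, which the descent lemma excludes unless both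
    -- coefficients vanish.
    have key : a 0 ^ 2 - C (h.coeff 0) * h * b 0 ^ 2 = 0 := by
      refine eq_zero_of_dvd_of_natDegree_lt (p := X ^ r) ?_ ?_
      · rw [hexp] at hab
        set A := ∑ j ∈ Finset.range J, a (j + 1) * X ^ (r * j)
        set B := ∑ j ∈ Finset.range J, b (j + 1) * X ^ (r * j)
        refine ⟨-(2 * a 0 * A) - X ^ r * A ^ 2 + h * h₁ * (b 0 + X ^ r * B) ^ 2
          + C (h.coeff 0) * h * (2 * b 0 * B + X ^ r * B ^ 2), ?_⟩
        linear_combination hab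
      · rw [natDegree_X_pow]
        refine (natDegree_sub_le _ _).trans_lt (max_lt ?_ ?_)
        · exact (natDegree_pow_le).trans_lt (ha 0)
        · by_cases hb0 : b 0 = 0
          · simpa [hb0] using Nat.pos_of_ne_zero hr
          · calc _ ≤ (C (h.coeff 0) * h).natDegree + (b 0 ^ 2).natDegree := natDegree_mul_le
              _ ≤ h.natDegree + 2 * (b 0).natDegree :=
                add_le_add (natDegree_C_mul_le _ _) natDegree_pow_le
              _ < r := by have := hb 0 hb0; omega
    have hb0 : b 0 = 0 := eq_zero_of_sq_eq_squarefree_mul_sq hsq hdeg hc (sub_eq_zero.1 key)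
    have ha0 : a 0 = 0 := by simpa [hb0] using key
    have hX : (X ^ r) ^ 2 ≠ (0 : F[X]) := pow_ne_zero _ (pow_ne_zero _ X_ne_zero)
    have := ih (fun j => a (j + 1)) (fun j => b (j + 1)) (fun j => ha _) (fun j => hb _) (by
      rw [ha0, hb0] at hab
      refine mul_left_cancel₀ hX ?_
      linear_combination hab)
    intro j hj
    cases j with
    | zero => exact ⟨ha0, hb0⟩
    | succ j => exact this j (by omega)

open Polynomial in
/-- **Stepanov's bound**: over the field `L` with `r²` elements, the value `h(y)` is a nonsquare
for at most `r²/2 + 2 e r` elements `y`. -/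
theorem Polynomial.two_mul_card_nonsquare_le {F L : Type*} [Field F] [Fintype F] [Field L]
    [Fintype L] [Algebra F L] [DecidableEq L] {h : F[X]} (hsq : Squarefree h)
    (hdeg : 0 < h.natDegree) (hc : h.coeff 0 ≠ 0) {r ρ e k : ℕ} (hrk : r = Fintype.card F ^ k)
    (hrρ : r = 2 * ρ + 1) (heρ : e < ρ) (he : 0 < e) (hh : h.natDegree ≤ 2 * e)
    (hL : Fintype.card L = r ^ 2) :
    2 * (Finset.univ.filter fun y : L => aeval y h ^ ((r ^ 2 - 1) / 2) = -1).card
      ≤ r ^ 2 + 4 * e * r := by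
  classical
  have hr0 : r ≠ 0 := by omega
  have frob : ∀ f : F[X], expand F r f = f ^ r := fun f => by rw [hrk]; exact expand_card_pow f k
  set J := ρ + e with hJ
  set H := h ^ (ρ + 1) with hH
  have hHdeg : H.natDegree ≤ 2 * e * (ρ + 1) :=
    natDegree_pow_le.trans (by rw [mul_comm]; exact Nat.mul_le_mul_right _ hh)
  -- the unknown coefficients, and the linear conditions on them
  let T : ((Fin J → degreeLT F (ρ + 1)) × (Fin J → degreeLT F (ρ + 1 - e))) →ₗ[F] F[X] :=
    { toFun := fun v => ∑ j : Fin J, X ^ (j : ℕ) *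
        (expand F r (v.1 j : F[X]) - H * expand F r (v.2 j : F[X]))
      map_add' := fun v w => by
        rw [← Finset.sum_add_distrib]
        refine Finset.sum_congr rfl fun j _ => ?_
        simp only [Prod.fst_add, Prod.snd_add, Pi.add_apply, Submodule.coe_add, map_add]
        ring
      map_smul' := fun c v => by
        rw [RingHom.id_apply, Finset.smul_sum]
        refine Finset.sum_congr rfl fun j _ => ?_
        simp only [Prod.smul_fst, Prod.smul_snd, Pi.smul_apply, Submodule.coe_smul, map_smul]
        simp only [smul_eq_C_mul]
        ring }
  have hTmem : ∀ v, T v ∈ degreeLT F (r * ρ + e + J) := by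
    intro v
    change ∑ j : Fin J, X ^ (j : ℕ) *
        (expand F r (v.1 j : F[X]) - H * expand F r (v.2 j : F[X])) ∈ _
    refine Submodule.sum_mem _ fun j _ => ?_
    rw [mem_degreeLT]
    have h1 : (v.1 j : F[X]).natDegree ≤ ρ := by
      have := mem_degreeLT.1 (v.1 j).2
      exact Nat.lt_succ_iff.1 (by
        by_cases h0 : (v.1 j : F[X]) = 0
        · simp [h0]
        · exact (natDegree_lt_iff_degree_lt h0).2 this)
    have h2 : (v.2 j : F[X]).natDegree + e ≤ ρ := by
      have := mem_degreeLT.1 (v.2 j).2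
      by_cases h0 : (v.2 j : F[X]) = 0
      · simp [h0]; omega
      · have := (natDegree_lt_iff_degree_lt h0).2 this
        omega
    refine (degree_le_natDegree).trans_lt ?_
    have h3 : (X ^ (j : ℕ) * (expand F r (v.1 j : F[X]) - H * expand F r (v.2 j : F[X]))).natDegree
        ≤ j + (r * ρ + e) := by
      refine natDegree_mul_le.trans (add_le_add (natDegree_X_pow_le _) ?_)
      refine (natDegree_sub_le _ _).trans (max_le ?_ ?_)
      · rw [natDegree_expand, mul_comm]
        exact (Nat.mul_le_mul_left _ h1).trans (Nat.le_add_right _ _)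
      · refine natDegree_mul_le.trans ?_
        rw [natDegree_expand]
        obtain ⟨s, hs⟩ := Nat.exists_eq_add_of_le h2
        have h4 : (v.2 j : F[X]).natDegree * r + e * r ≤ ρ * r := by
          rw [← add_mul]; exact Nat.mul_le_mul_right _ h2
        -- The degree of H costs er + e; requiring deg b ≤ ρ - e recovers er, so both kinds of terms
        -- stay within rρ + e.
        have h5 : 2 * e * (ρ + 1) = e * r + e := by rw [hrρ]; ring
        rw [mul_comm r ρ]
        omega
    exact_mod_cast (by have := j.2; omega :
      (X ^ (j : ℕ) * (expand F r (v.1 j : F[X]) - H * expand F r (v.2 j : F[X]))).natDegree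
        < r * ρ + e + J)
  -- With J = ρ + e the unknowns outnumber the conditions by exactly e(ρ - e), positive because 0 <
  -- e < ρ.
  obtain ⟨v, hv, hv0⟩ : ∃ v, T v = 0 ∧ v ≠ 0 := by
    have hlt : Module.finrank F (degreeLT F (r * ρ + e + J)) < Module.finrank F
        ((Fin J → degreeLT F (ρ + 1)) × (Fin J → degreeLT F (ρ + 1 - e))) := by
      have f1 : ∀ n, Module.finrank F (degreeLT F n) = n := fun n => by
        rw [(degreeLTEquiv F n).finrank_eq]; simp
      have : Module.finrank F
        ((Fin J → degreeLT F (ρ + 1)) × (Fin J → degreeLT F (ρ + 1 - e))) = J * (ρ + 1) + J * (ρ + 1 - e) := by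
        rw [Module.finrank_prod, Module.finrank_pi_fintype, Module.finrank_pi_fintype]
        simp [f1]
      rw [this, f1]
      obtain ⟨s, rfl⟩ := Nat.exists_eq_add_of_lt heρ
      rw [hJ, hrρ, show e + s + 1 + 1 - e = s + 2 by omega]
      nlinarith
    have hfin : ∀ n, Module.Finite F (degreeLT F n) := fun n =>
      Module.Finite.equiv (degreeLTEquiv F n).symm
    have := hfin (r * ρ + e + J)
    have := hfin (ρ + 1)
    have := hfin (ρ + 1 - e)
    have hk := LinearMap.ker_ne_bot_of_finrank_lt (f := T.codRestrict _ hTmem) hlt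
    obtain ⟨v, hv, hv0⟩ := Submodule.exists_mem_ne_zero_of_ne_bot hk
    exact ⟨v, congrArg Subtype.val (LinearMap.mem_ker.1 hv), hv0⟩
  let a : ℕ → F[X] := fun j => if hj : j < J then (v.1 ⟨j, hj⟩ : F[X]) else 0
  let b : ℕ → F[X] := fun j => if hj : j < J then (v.2 ⟨j, hj⟩ : F[X]) else 0
  have ha : ∀ j, (a j).natDegree ≤ ρ := by
    intro j
    by_cases hj : j < J
    · have : a j = v.1 ⟨j, hj⟩ := dif_pos hj
      rw [this]
      have := mem_degreeLT.1 (v.1 ⟨j, hj⟩).2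
      exact Nat.lt_succ_iff.1 (by
        by_cases h0 : (v.1 ⟨j, hj⟩ : F[X]) = 0
        · simp [h0]
        · exact (natDegree_lt_iff_degree_lt h0).2 this)
    · simp [a, hj]
  have hb : ∀ j, (b j).natDegree + e ≤ ρ := by
    intro j
    by_cases hj : j < J
    · have : b j = v.2 ⟨j, hj⟩ := dif_pos hj
      rw [this]
      have := mem_degreeLT.1 (v.2 ⟨j, hj⟩).2
      by_cases h0 : (v.2 ⟨j, hj⟩ : F[X]) = 0
      · simp [h0]; omega
      · have := (natDegree_lt_iff_degree_lt h0).2 this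
        omega
    · simp [b, hj]; omega
  have hT : ∑ j ∈ Finset.range J, X ^ j * (a j ^ r - H * b j ^ r) = 0 := by
    rw [← hv, Finset.sum_range]
    refine Finset.sum_congr rfl fun j _ => ?_
    simp [a, b, frob]
  -- The auxiliary polynomial: it vanishes wherever h is a nonsquare, and its degree is about r²/2.
  set θ : F[X] := ∑ j ∈ Finset.range J, (a j + H * b j) * X ^ (r * j) with hθ
  -- Here H² = h^(r+1) = h · h(X^r), so θ = 0 would give the relation excluded by
  -- `stepanov_independence`.
  have hθ0 : θ ≠ 0 := by
    intro h0
    have hsplit : ∑ j ∈ Finset.range J, a j * X ^ (r * j)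
        = -(H * ∑ j ∈ Finset.range J, b j * X ^ (r * j)) := by
      rw [eq_neg_iff_add_eq_zero, ← h0, hθ, Finset.mul_sum, ← Finset.sum_add_distrib]
      exact Finset.sum_congr rfl fun j _ => by ring
    have hind := stepanov_independence hsq hdeg hc hr0 hh J a b
      (fun j => by have := ha j; omega) (fun j _ => by have := hb j; omega) (by
        rw [hsplit, neg_sq, mul_pow, frob, hH, ← pow_mul, ← pow_succ', hrρ]
        ring)
    apply hv0
    ext j : 3
    · have := (hind j j.2).1
      simpa [a] using this
    · have := (hind j j.2).2
      simpa [b] using this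
  -- Raising θ(y) to the power r turns y^(rj) into y^j, and H(y)^r = -H(y) because (ρ+1)r = (r²-1)/2
  -- + (ρ+1). What remains is the relation `hT` evaluated at y.
  have hroot : ∀ y : L, aeval y h ^ ((r ^ 2 - 1) / 2) = -1 → aeval y θ = 0 := by
    intro y hy
    have hθr : θ ^ r = ∑ j ∈ Finset.range J, (a j ^ r + H ^ r * b j ^ r) * X ^ (r * r * j) := by
      rw [← frob, hθ, map_sum]
      refine Finset.sum_congr rfl fun j _ => ?_
      rw [map_mul, map_add, map_mul, frob, frob, frob, frob, ← pow_mul]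
      ring
    have hyr : y ^ (r * r) = y := by
      rw [← sq, ← hL]; exact FiniteField.pow_card y
    have hHr : aeval y (H ^ r) = -aeval y H := by
      have e1 : (ρ + 1) * r = (r ^ 2 - 1) / 2 + (ρ + 1) := by
        have : r ^ 2 - 1 = 2 * (2 * ρ * (ρ + 1)) := by
          rw [hrρ]; refine Nat.sub_eq_of_eq_add ?_; ring
        rw [this, Nat.mul_div_cancel_left _ two_pos, hrρ]; ring
      rw [hH, ← pow_mul, e1, pow_add, map_mul, map_pow, hy, neg_one_mul]
    have : (aeval y θ) ^ r = 0 := by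
      rw [← map_pow, hθr, map_sum]
      have := congrArg (aeval y) hT
      rw [map_sum, map_zero] at this
      rw [← this]
      refine Finset.sum_congr rfl fun j _ => ?_
      have hX : aeval y (X ^ (r * r * j) : F[X]) = y ^ j := by
        rw [map_pow, aeval_X, pow_mul, hyr]
      simp only [map_mul, map_add, map_sub, hHr, hX, aeval_X_pow]
      ring
    exact pow_eq_zero_iff hr0 |>.1 this
  have hθdeg : 2 * θ.natDegree ≤ r ^ 2 + 4 * e * r := by
    have : θ.natDegree ≤ 2 * e * (ρ + 1) + ρ + r * (J - 1) := by
      refine natDegree_sum_le_of_forall_le _ _ fun j hj => ?_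
      have hj := Finset.mem_range.1 hj
      refine natDegree_mul_le.trans (add_le_add ?_ ?_)
      · refine (natDegree_add_le _ _).trans (max_le ((ha j).trans (Nat.le_add_left _ _)) ?_)
        exact natDegree_mul_le.trans (add_le_add hHdeg ((Nat.le_add_right _ _).trans (hb j)))
      · exact (natDegree_X_pow_le _).trans (Nat.mul_le_mul_left _ (by omega))
    obtain ⟨s, rfl⟩ := Nat.exists_eq_add_of_lt heρ
    rw [hJ, show e + s + 1 + e - 1 = 2 * e + s by omega, hrρ] at this
    rw [hrρ]
    nlinarith
  have hcard : (Finset.univ.filter fun y : L => aeval y h ^ ((r ^ 2 - 1) / 2) = -1).card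
      ≤ θ.natDegree := by
    have hmap : θ.map (algebraMap F L) ≠ 0 :=
      (Polynomial.map_ne_zero_iff (algebraMap F L).injective).2 hθ0
    rw [← natDegree_map (algebraMap F L)]
    refine le_trans (Finset.card_le_card (t := (θ.map (algebraMap F L)).roots.toFinset) ?_)
      ((Multiset.toFinset_card_le _).trans (card_roots' _))
    intro y hy
    rw [Multiset.mem_toFinset, mem_roots hmap, IsRoot.def, eval_map_algebraMap]
    exact hroot y (Finset.mem_filter.1 hy).2
  omega

/-! ### Kloosterman sums and their behaviour under quadratic extension. -/

/-- The Kloosterman sum `∑_{x ≠ 0} ψ(a x + b / x)` over a finite field. -/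
noncomputable def kloostermanSum {F : Type*} [Field F] [Fintype F] (ψ : AddChar F ℂ) (a b : F) : ℂ :=
  open Classical in ∑ x : F, if x = 0 then 0 else ψ (a * x + b * x⁻¹)

/-- The additive character `ψ ∘ Tr` of an extension `L` of `F`. -/
noncomputable def AddChar.compTrace {F : Type*} [Field F] (ψ : AddChar F ℂ) (L : Type*) [Field L]
    [Algebra F L] : AddChar L ℂ :=
  ψ.compAddMonoidHom (Algebra.trace F L).toAddMonoidHom

theorem AddChar.compTrace_apply {F : Type*} [Field F] (ψ : AddChar F ℂ) (L : Type*) [Field L]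
    [Algebra F L] (x : L) : ψ.compTrace L x = ψ (Algebra.trace F L x) := rfl

theorem kloostermanSum_conj {F : Type*} [Field F] [Fintype F] (ψ : AddChar F ℂ) (a b : F) :
    (starRingEnd ℂ) (kloostermanSum ψ a b) = kloostermanSum ψ a b := by
  classical
  unfold kloostermanSum
  rw [map_sum]
  refine Fintype.sum_equiv (Equiv.neg F) _ _ fun x => ?_
  simp only [Equiv.neg_apply, neg_eq_zero]
  split_ifs with h
  · simp
  · rw [← AddChar.map_neg_eq_conj]
    congr 1
    rw [inv_neg]
    ring

theorem kloostermanSum_im {F : Type*} [Field F] [Fintype F] (ψ : AddChar F ℂ) (a b : F) :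
    (kloostermanSum ψ a b).im = 0 :=
  Complex.conj_eq_iff_im.1 (kloostermanSum_conj ψ a b)

theorem sum_sq_eq_sum_quadraticChar {F : Type*} [Field F] [Fintype F] [DecidableEq F]
    (hF : ringChar F ≠ 2) (f : F → ℂ) :
    ∑ y, f (y ^ 2) = ∑ m, ((quadraticChar F m : ℤ) + 1 : ℂ) * f m := by
  rw [← Finset.sum_fiberwise_of_maps_to (s := Finset.univ) (t := Finset.univ)
    (g := fun y : F => y ^ 2) (fun _ _ => Finset.mem_univ _)]
  refine Finset.sum_congr rfl fun m _ => ?_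
  have h := quadraticChar_card_sqrts hF m
  rw [Set.toFinset_ofPred] at h
  rw [Finset.sum_congr rfl (g := fun _ => f m) (fun y hy => by rw [(Finset.mem_filter.1 hy).2]),
    Finset.sum_const, nsmul_eq_mul]
  congr 1
  exact_mod_cast h

/-- The numbers of representations of m as y² and as gy² are 1 + χ(m) and 1 - χ(m), with sum 2. -/
theorem sum_sq_add_sum_nonsquare_mul_sq {F : Type*} [Field F] [Fintype F] (hF : ringChar F ≠ 2)
    {g : F} (hg : ¬IsSquare g) (f : F → ℂ) :
    ∑ y, f (y ^ 2) + ∑ y, f (g * y ^ 2) = 2 * ∑ m, f m := by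
  classical
  have hg0 : g ≠ 0 := by rintro rfl; exact hg (IsSquare.zero)
  have hχ : quadraticChar F g = -1 := quadraticChar_neg_one_iff_not_isSquare.2 hg
  rw [sum_sq_eq_sum_quadraticChar hF, sum_sq_eq_sum_quadraticChar hF (fun m => f (g * m))]
  have : ∑ m, ((quadraticChar F m : ℤ) + 1 : ℂ) * f (g * m)
      = ∑ m, (-(quadraticChar F m : ℤ) + 1 : ℂ) * f m := by
    refine Fintype.sum_equiv (Equiv.mulLeft₀ g hg0) _ _ fun m => ?_
    simp only [Equiv.mulLeft₀_apply, map_mul, hχ]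
    push_cast
    ring
  rw [this, ← Finset.sum_add_distrib, Finset.mul_sum]
  exact Finset.sum_congr rfl fun m _ => by ring

/-- The two summation variables are written as x + y and x - y, so that their sum is 2x and their
product x² - y². This matches trace and norm in a quadratic extension. -/
theorem kloostermanSum_sq {F : Type*} [Field F] [Fintype F] [DecidableEq F] (hF : ringChar F ≠ 2)
    (ψ : AddChar F ℂ) (a b : F) :
    kloostermanSum ψ a b ^ 2 = ∑ x : F, ∑ y : F,
      if x ^ 2 = y ^ 2 then 0 else ψ (2 * a * x + 2 * b * x * (x ^ 2 - y ^ 2)⁻¹) := by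
  have h2 : (2 : F) ≠ 0 := Ring.two_ne_zero hF
  unfold kloostermanSum
  rw [sq, Finset.sum_mul_sum, ← Finset.sum_product', ← Finset.sum_product']
  refine (Finset.sum_nbij' (fun p => (p.1 + p.2, p.1 - p.2))
    (fun p => ((p.1 + p.2) / 2, (p.1 - p.2) / 2)) (by simp) (by simp) ?_ ?_ ?_).symm
  · rintro ⟨x, y⟩ -
    ext <;> simp only <;> field_simp <;> ring
  · rintro ⟨x, y⟩ -
    ext <;> simp only <;> field_simp <;> ring
  · rintro ⟨x, y⟩ -
    simp only
    by_cases h1 : x + y = 0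
    · rw [if_pos (by linear_combination (x - y) * h1), if_pos h1, zero_mul]
    by_cases h2 : x - y = 0
    · rw [if_pos (by linear_combination (x + y) * h2), if_pos h2, mul_zero]
    have h3 : x ^ 2 - y ^ 2 = (x + y) * (x - y) := by ring
    have h4 : x ^ 2 ≠ y ^ 2 := fun h => by
      rw [← sub_eq_zero, h3] at h; exact mul_ne_zero h1 h2 h
    rw [if_neg h1, if_neg h2, if_neg h4, ← AddChar.map_add_eq_mul, h3]
    congr 1
    field_simp
    ring

/-- A quadratic extension of a finite field of odd characteristic is generated by a square root of
a nonsquare. -/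
theorem FiniteField.exists_sqrt_nonsquare {F L : Type*} [Field F] [Fintype F] [Field L] [Fintype L]
    [Algebra F L] (hF : ringChar F ≠ 2) (hL : Fintype.card L = Fintype.card F ^ 2) :
    ∃ g : F, ∃ w : L, ¬IsSquare g ∧ w ^ 2 = algebraMap F L g ∧ w ^ Fintype.card F = -w := by
  obtain ⟨g, hg⟩ := FiniteField.exists_nonsquare hF
  have hg0 : g ≠ 0 := by rintro rfl; exact hg IsSquare.zero
  have hg1 : g ^ (Fintype.card F / 2) = -1 :=
    (FiniteField.pow_dichotomy hF hg0).resolve_left fun h => hg ((FiniteField.isSquare_iff hF hg0).2 h)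
  have hchar : ringChar L ≠ 2 := by rwa [← Algebra.ringChar_eq F L]
  obtain ⟨n, hn⟩ : ∃ n, Fintype.card F = 2 * n + 1 := by
    have := FiniteField.odd_card_of_char_ne_two hF
    exact ⟨Fintype.card F / 2, by omega⟩
  have hn' : Fintype.card F / 2 = n := by omega
  have hsq : IsSquare (algebraMap F L g) := by
    refine (FiniteField.isSquare_iff hchar (by simpa using hg0)).2 ?_
    have : Fintype.card L / 2 = n * (2 * (n + 1)) := by
      have : Fintype.card L = 2 * (n * (2 * (n + 1))) + 1 := by rw [hL, hn]; ring
      omega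
    rw [this, pow_mul, ← map_pow, ← hn', hg1]
    simp [pow_mul]
  obtain ⟨w, hw⟩ := hsq
  refine ⟨g, w, hg, by rw [hw, sq], ?_⟩
  rw [hn, pow_succ, pow_mul, sq, ← hw, ← map_pow, ← hn', hg1]
  simp

theorem FiniteField.trace_quadratic {F L : Type*} [Field F] [Fintype F] [Field L] [Fintype L]
    [Algebra F L] (hL : Fintype.card L = Fintype.card F ^ 2) (z : L) :
    algebraMap F L (Algebra.trace F L z) = z + z ^ Fintype.card F := by
  have : Module.finrank F L = 2 := by
    have h := Module.card_eq_pow_finrank (K := F) (V := L)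
    rw [hL] at h
    exact (Nat.pow_right_injective (Fintype.one_lt_card) h).symm
  rw [FiniteField.algebraMap_trace_eq_sum_pow, this]
  simp [Finset.sum_range_succ]

/-- The Hasse–Davenport relation for Kloosterman sums and a quadratic extension. -/
theorem kloostermanSum_quadratic {F L : Type*} [Field F] [Fintype F] [Field L] [Fintype L]
    [Algebra F L] (hF : ringChar F ≠ 2) (hL : Fintype.card L = Fintype.card F ^ 2)
    {ψ : AddChar F ℂ} (hψ : ψ ≠ 1) {a b : F} (ha : a ≠ 0) (hb : b ≠ 0) :
    kloostermanSum (ψ.compTrace L) (algebraMap F L a) (algebraMap F L b)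
      = 2 * Fintype.card F - kloostermanSum ψ a b ^ 2 := by
  classical
  obtain ⟨g, w, hg, hw, hwq⟩ := FiniteField.exists_sqrt_nonsquare (L := L) hF hL
  have h2 : (2 : F) ≠ 0 := Ring.two_ne_zero hF
  have hg0 : g ≠ 0 := by rintro rfl; exact hg IsSquare.zero
  have hw0 : w ≠ 0 := by
    rintro rfl
    apply hg0
    simpa using hw.symm
  have htr : ∀ x y : F, Algebra.trace F L (algebraMap F L x + algebraMap F L y * w) = 2 * x := by
    intro x y
    apply (algebraMap F L).injective
    rw [FiniteField.trace_quadratic hL]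
    obtain ⟨p, hp⟩ := CharP.exists F
    have := charP_of_injective_algebraMap (algebraMap F L).injective p
    obtain ⟨n, hpp, hn⟩ := FiniteField.card F p
    have := Fact.mk hpp
    have e : (algebraMap F L x + algebraMap F L y * w) ^ Fintype.card F
        = algebraMap F L x - algebraMap F L y * w := by
      have e1 := add_pow_char_pow (algebraMap F L x) (algebraMap F L y * w) p n
      rw [← hn] at e1
      rw [e1, mul_pow, hwq, ← map_pow, ← map_pow, FiniteField.pow_card, FiniteField.pow_card]
      ring
    rw [e, map_mul, map_ofNat]
    ring
  have hinj : Function.Injective fun p : F × F => algebraMap F L p.1 + algebraMap F L p.2 * w := by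
    rintro ⟨x, y⟩ ⟨x', y'⟩ h
    simp only at h
    have h1 := congrArg (Algebra.trace F L) h
    rw [htr, htr] at h1
    have h1 := mul_left_cancel₀ h2 h1
    rw [h1] at h
    have h3 := (algebraMap F L).injective (mul_right_cancel₀ hw0 (add_left_cancel h))
    rw [h1, h3]
  have hbij : Function.Bijective fun p : F × F => algebraMap F L p.1 + algebraMap F L p.2 * w := by
    rw [Fintype.bijective_iff_injective_and_card]
    exact ⟨hinj, by rw [Fintype.card_prod, hL, sq]⟩
  -- For z = x + yw the trace is 2x and the norm x² - gy²: the sum over L is the expression for the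
  -- square of the sum over F with y² replaced by gy².
  have hKL : kloostermanSum (ψ.compTrace L) (algebraMap F L a) (algebraMap F L b)
      = ∑ x : F, ∑ y : F, if x ^ 2 = g * y ^ 2 then 0
        else ψ (2 * a * x + 2 * b * x * (x ^ 2 - g * y ^ 2)⁻¹) := by
    unfold kloostermanSum
    rw [← Fintype.sum_prod_type']
    refine (Fintype.sum_bijective _ hbij _ _ ?_).symm
    rintro ⟨x, y⟩
    simp only
    set z := algebraMap F L x + algebraMap F L y * w with hz
    have hnorm : z * (algebraMap F L x - algebraMap F L y * w)
        = algebraMap F L (x ^ 2 - g * y ^ 2) := by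
      rw [hz, map_sub, map_mul, map_pow, map_pow, ← hw]; ring
    by_cases h : x ^ 2 = g * y ^ 2
    · have hy : y = 0 := by
        by_contra hy
        exact hg ⟨x / y, by field_simp; exact h.symm⟩
      have hx : x = 0 := by simpa [hy] using h
      rw [if_pos h, if_pos (by simp [hz, hx, hy])]
    · have hN : x ^ 2 - g * y ^ 2 ≠ 0 := sub_ne_zero.2 h
      have hz0 : z ≠ 0 := by
        intro hz0
        rw [hz0, zero_mul] at hnorm
        exact hN ((map_eq_zero _).1 hnorm.symm)
      rw [if_neg h, if_neg hz0, AddChar.compTrace_apply]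
      congr 1
      have hinv : z⁻¹ = algebraMap F L (x ^ 2 - g * y ^ 2)⁻¹
          * (algebraMap F L x - algebraMap F L y * w) := by
        rw [map_inv₀, ← hnorm]
        have h5 : (algebraMap F L x - algebraMap F L y * w) ≠ 0 := by
          intro h5
          rw [h5, mul_zero] at hnorm
          exact hN ((map_eq_zero _).1 hnorm.symm)
        field_simp
      have : algebraMap F L a * z + algebraMap F L b * z⁻¹
          = algebraMap F L (a * x + b * (x ^ 2 - g * y ^ 2)⁻¹ * x)
            + algebraMap F L (a * y - b * (x ^ 2 - g * y ^ 2)⁻¹ * y) * w := by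
        rw [hinv, hz]
        simp only [map_mul, map_add, map_sub]
        ring
      rw [this, htr]
      ring
  -- Together y² and gy² cover every value twice, so n = x² - m runs freely. The phase is then
  -- linear in x, and orthogonality leaves only n = -b/a.
  have hsum : kloostermanSum (ψ.compTrace L) (algebraMap F L a) (algebraMap F L b)
      + kloostermanSum ψ a b ^ 2 = 2 * Fintype.card F := by
    rw [hKL, kloostermanSum_sq hF, add_comm, ← Finset.sum_add_distrib]
    have : ∀ x : F, ((∑ y : F, if x ^ 2 = y ^ 2 then 0
          else ψ (2 * a * x + 2 * b * x * (x ^ 2 - y ^ 2)⁻¹))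
        + ∑ y : F, if x ^ 2 = g * y ^ 2 then 0
          else ψ (2 * a * x + 2 * b * x * (x ^ 2 - g * y ^ 2)⁻¹))
        = 2 * ∑ n : F, if n = 0 then 0 else ψ (x * (2 * a + 2 * b * n⁻¹)) := by
      intro x
      rw [sum_sq_add_sum_nonsquare_mul_sq hF hg (fun m => if x ^ 2 = m then 0
          else ψ (2 * a * x + 2 * b * x * (x ^ 2 - m)⁻¹))]
      congr 1
      refine Fintype.sum_equiv (Equiv.subLeft (x ^ 2)) _ _ fun m => ?_
      simp only [Equiv.subLeft_apply, sub_eq_zero]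
      split_ifs
      · rfl
      · congr 1; ring
    rw [Finset.sum_congr rfl fun x _ => this x, ← Finset.mul_sum, Finset.sum_comm]
    congr 1
    rw [Finset.sum_eq_single (-b / a)]
    · have hne : -b / a ≠ 0 := div_ne_zero (neg_ne_zero.2 hb) ha
      simp only [if_neg hne]
      rw [AddChar.sum_mulShift _ (AddChar.IsPrimitive.of_ne_one hψ), if_pos]
      field_simp
      ring
    · intro n _ hn
      by_cases hn0 : n = 0
      · simp [hn0]
      · simp only [if_neg hn0]
        rw [AddChar.sum_mulShift _ (AddChar.IsPrimitive.of_ne_one hψ), if_neg, Nat.cast_zero]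
        intro h
        apply hn
        field_simp at h
        rw [eq_div_iff ha]
        have : (2 : F) * (n * a + b) = 0 := by linear_combination h
        have := (mul_eq_zero.1 this).resolve_left h2
        linear_combination this
    · simp
  linear_combination hsum

theorem kloostermanSum_eq_sum_ite {F : Type*} [Field F] [Fintype F] [DecidableEq F]
    (ψ : AddChar F ℂ) (a b : F) :
    kloostermanSum ψ a b = ∑ x : F, if x = 0 then 0 else ψ (a * x + b * x⁻¹) := by
  unfold kloostermanSum
  congr!

/-! ### Points of an Artin–Schreier curve and averages of Kloosterman sums. -/

section ArtinSchreier

open Polynomial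

variable {F : Type*} [Field F] [Fintype F]

/-- The discriminant of the quadratic equation `a x + b / x = y ^ q - y` in `x`. -/
noncomputable def artinSchreierDisc (a b : F) : F[X] :=
  (X ^ Fintype.card F - X) ^ 2 - C (4 * a * b)

/-- The derivative is -2(X^q - X), and the discriminant is a nonzero constant modulo X^q - X; the
two are therefore coprime. -/
theorem artinSchreierDisc_squarefree (hF : ringChar F ≠ 2) {a b : F} (ha : a ≠ 0) (hb : b ≠ 0) :
    Squarefree (artinSchreierDisc a b) := by
  have h2 : (2 : F) ≠ 0 := Ring.two_ne_zero hF
  refine Separable.squarefree ?_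
  have hd : derivative (artinSchreierDisc a b) = -2 * (X ^ Fintype.card F - X) := by
    unfold artinSchreierDisc
    simp only [derivative_sub, derivative_C, derivative_pow, derivative_X, Nat.cast_ofNat,
      FiniteField.cast_card_eq_zero, map_zero, map_ofNat, zero_mul]
    ring
  have hC : C (8 * a * b)⁻¹ * (8 * C a * C b) = (1 : F[X]) := by
    have : (8 * C a * C b : F[X]) = C (8 * a * b) := by
      rw [C_mul, C_mul, map_ofNat C 8]
    rw [this, ← C_mul, inv_mul_cancel₀, C_1]
    have : (8 : F) = 2 ^ 3 := by norm_num
    rw [this]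
    positivity
  refine ⟨-2 * C (8 * a * b)⁻¹, -C (8 * a * b)⁻¹ * (X ^ Fintype.card F - X), ?_⟩
  rw [hd, ← hC]
  unfold artinSchreierDisc
  rw [show C (4 * a * b) = 4 * C a * C b by
    rw [C_mul, C_mul, map_ofNat C 4]]
  ring

theorem artinSchreierDisc_natDegree (a b : F) :
    (artinSchreierDisc a b).natDegree = 2 * Fintype.card F := by
  unfold artinSchreierDisc
  rw [natDegree_sub_C, natDegree_pow, FiniteField.X_pow_card_sub_X_natDegree_eq F
    Fintype.one_lt_card]

theorem artinSchreierDisc_coeff_zero (a b : F) :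
    (artinSchreierDisc a b).coeff 0 = -(4 * a * b) := by
  rw [coeff_zero_eq_eval_zero]
  simp [artinSchreierDisc]

variable {L : Type*} [Field L] [Fintype L] [Algebra F L]

omit [Fintype L] in
theorem aeval_artinSchreierDisc (a b : F) (y : L) : aeval y (artinSchreierDisc a b)
    = (y ^ Fintype.card F - y) ^ 2 - 4 * algebraMap F L a * algebraMap F L b := by
  have h4 : algebraMap F L 4 = 4 := map_ofNat _ 4
  simp [artinSchreierDisc, h4]

/-- Points of the curve `y ^ q - y = a x + b / x` over `L`, bounded from below. -/
theorem le_card_artinSchreier [DecidableEq L] (hF : ringChar F ≠ 2) {a b : F} (ha : a ≠ 0)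
    (hb : b ≠ 0) {r k : ℕ} (hrk : r = Fintype.card F ^ k) (hr : 2 * Fintype.card F + 2 ≤ r)
    (hL : Fintype.card L = r ^ 2) :
    r ^ 2 ≤ (Finset.univ.filter fun p : L × L => p.1 ≠ 0 ∧ p.2 ^ Fintype.card F - p.2
      = algebraMap F L a * p.1 + algebraMap F L b * p.1⁻¹).card
      + 4 * Fintype.card F * r + 4 * Fintype.card F := by
  set q := Fintype.card F with hq
  set h := artinSchreierDisc a b with hh
  have hchar : ringChar L ≠ 2 := by rwa [← Algebra.ringChar_eq F L]
  have h2 : (2 : L) ≠ 0 := Ring.two_ne_zero hchar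
  have h2F : (2 : F) ≠ 0 := Ring.two_ne_zero hF
  have ha' : algebraMap F L a ≠ 0 := by simpa using ha
  have hb' : algebraMap F L b ≠ 0 := by simpa using hb
  have hq0 : 0 < q := Fintype.card_pos
  have hqodd := FiniteField.odd_card_of_char_ne_two hF
  have hrodd : r % 2 = 1 := by
    rw [hrk, Nat.pow_mod, hqodd, one_pow]
    rfl
  have hdeg := artinSchreierDisc_natDegree a b
  rw [← hh, ← hq] at hdeg
  have h0 : h ≠ 0 := by intro h0; rw [h0, natDegree_zero] at hdeg; omega
  -- The discriminant has degree 2q, so e = q; the hypothesis 2q + 2 ≤ r is what e < ρ = (r-1)/2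
  -- needs.
  have hN := two_mul_card_nonsquare_le (L := L) (artinSchreierDisc_squarefree hF ha hb)
    (by rw [← hh, hdeg]; omega)
    (by rw [artinSchreierDisc_coeff_zero, show (4 : F) = 2 ^ 2 by norm_num]
        exact neg_ne_zero.2 (by positivity))
    hrk (ρ := r / 2) (e := q) (by omega) (by omega) hq0 (by rw [← hh, hdeg]) hL
  rw [← hh] at hN
  have hZ : (Finset.univ.filter fun y : L => aeval y h = 0).card ≤ 2 * q := by
    have hmap : h.map (algebraMap F L) ≠ 0 :=
      (Polynomial.map_ne_zero_iff (algebraMap F L).injective).2 h0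
    rw [← hdeg, ← natDegree_map (algebraMap F L)]
    refine le_trans (Finset.card_le_card (t := (h.map (algebraMap F L)).roots.toFinset) ?_)
      ((Multiset.toFinset_card_le _).trans (card_roots' _))
    intro y hy
    rw [Multiset.mem_toFinset, mem_roots hmap, IsRoot.def, eval_map_algebraMap]
    exact (Finset.mem_filter.1 hy).2
  have hhalf : Fintype.card L / 2 = (r ^ 2 - 1) / 2 := by
    have : r ^ 2 % 2 = 1 := by rw [Nat.pow_mod, hrodd]
    rw [hL]
    omega
  set G := Finset.univ.filter fun y : L => aeval y h ≠ 0 ∧ IsSquare (aeval y h) with hG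
  have hcover : r ^ 2 ≤ G.card
      + (Finset.univ.filter fun y : L => aeval y h ^ ((r ^ 2 - 1) / 2) = -1).card
      + (Finset.univ.filter fun y : L => aeval y h = 0).card := by
    refine le_trans (hL.symm.trans Finset.card_univ.symm).le ?_
    refine le_trans (Finset.card_le_card (t := (G ∪ _) ∪ _) ?_) ((Finset.card_union_le _ _).trans
      (Nat.add_le_add_right (Finset.card_union_le _ _) _))
    intro y _
    simp only [hG, Finset.mem_union, Finset.mem_filter, Finset.mem_univ, true_and]
    by_cases hy : aeval y h = 0
    · exact Or.inr hy
    · rcases FiniteField.pow_dichotomy hchar hy with h1 | h1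
      · exact Or.inl (Or.inl ⟨hy, (FiniteField.isSquare_iff hchar hy).2 h1⟩)
      · exact Or.inl (Or.inr (by rwa [hhalf] at h1))
  -- When the discriminant is a nonzero square s², the two roots x = (y^q - y ± s)/(2a) are distinct
  -- and nonzero.
  have hGP : 2 * G.card ≤ (Finset.univ.filter fun p : L × L => p.1 ≠ 0 ∧ p.2 ^ q - p.2
      = algebraMap F L a * p.1 + algebraMap F L b * p.1⁻¹).card := by
    set P := (Finset.univ.filter fun p : L × L => p.1 ≠ 0 ∧ p.2 ^ q - p.2
      = algebraMap F L a * p.1 + algebraMap F L b * p.1⁻¹) with hP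
    refine le_trans ?_ (Finset.card_le_card (Finset.filter_subset (fun p => p.2 ∈ G) P))
    refine Finset.mul_card_image_le_card_of_maps_to (f := Prod.snd)
      (fun p hp => (Finset.mem_filter.1 hp).2) 2 ?_
    intro y hy
    have hyG := hy
    obtain ⟨hy0, s, hs⟩ := (Finset.mem_filter.1 hy).2
    have hs0 : s ≠ 0 := by rintro rfl; exact hy0 (by simpa using hs)
    rw [hh, aeval_artinSchreierDisc, ← hq] at hs
    have hsol : ∀ u : L, u ^ 2 = s ^ 2 → ((y ^ q - y + u) / (2 * algebraMap F L a), y) ∈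
        (P.filter fun p => p.2 ∈ G).filter fun p => p.2 = y := by
      intro u hu
      simp only [hP, Finset.mem_filter, Finset.mem_univ, true_and, and_true]
      have hprod : (y ^ q - y + u) * (y ^ q - y - u) = 4 * algebraMap F L a * algebraMap F L b := by
        linear_combination hs - hu
      have hne : y ^ q - y + u ≠ 0 := by
        intro h0
        rw [h0, zero_mul, show (4 : L) = 2 ^ 2 by norm_num] at hprod
        exact (mul_ne_zero (mul_ne_zero (pow_ne_zero 2 h2) ha') hb') hprod.symm
      refine ⟨⟨div_ne_zero hne (mul_ne_zero h2 ha'), ?_⟩, hyG⟩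
      field_simp
      linear_combination hprod
    refine Finset.one_lt_card.2 ⟨_, hsol s rfl, _, hsol (-s) (neg_sq s), ?_⟩
    intro heq
    have := (Prod.ext_iff.1 heq).1
    simp only at this
    field_simp at this
    have h3 : 2 * s = 0 := by linear_combination this
    exact (mul_ne_zero h2 hs0) h3
  omega

theorem trace_pow_card_sub_self (y : L) :
    Algebra.trace F L (y ^ Fintype.card F - y) = 0 := by
  rw [map_sub, sub_eq_zero]
  exact Algebra.trace_eq_of_algEquiv (FiniteField.frobeniusAlgEquivOfAlgebraic F L) y

/-- A value y^q - y has trace zero, and a given value is attained by at most q elements y, the roots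
of a polynomial of degree q. -/
theorem card_artinSchreier_le [DecidableEq L] [DecidableEq F] (a b : F) :
    (Finset.univ.filter fun p : L × L => p.1 ≠ 0 ∧ p.2 ^ Fintype.card F - p.2
      = algebraMap F L a * p.1 + algebraMap F L b * p.1⁻¹).card
      ≤ Fintype.card F * (Finset.univ.filter fun x : L => x ≠ 0 ∧
        Algebra.trace F L (algebraMap F L a * x + algebraMap F L b * x⁻¹) = 0).card := by
  refine Finset.card_le_mul_card_image_of_maps_to (f := Prod.fst) ?_ _ ?_
  · intro p hp
    obtain ⟨hp0, hp⟩ := (Finset.mem_filter.1 hp).2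
    refine Finset.mem_filter.2 ⟨Finset.mem_univ _, hp0, ?_⟩
    rw [← hp, trace_pow_card_sub_self]
  · intro x _
    set c := algebraMap F L a * x + algebraMap F L b * x⁻¹ with hc
    have hdeg : (X ^ Fintype.card F - X - C c : L[X]).natDegree = Fintype.card F := by
      rw [natDegree_sub_C, FiniteField.X_pow_card_sub_X_natDegree_eq L Fintype.one_lt_card]
    have h0 : (X ^ Fintype.card F - X - C c : L[X]) ≠ 0 := by
      intro h0
      rw [h0, natDegree_zero] at hdeg
      exact Fintype.card_ne_zero hdeg.symm
    refine le_trans ?_ (((Multiset.toFinset_card_le _).trans (card_roots' _)).trans hdeg.le)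
    refine Finset.card_le_card_of_injOn Prod.snd ?_ ?_
    · intro p hp
      simp only [Finset.coe_filter, Finset.mem_filter, Finset.mem_univ, true_and,
        Set.mem_ofPred_eq] at hp
      obtain ⟨⟨_, hp⟩, rfl⟩ := hp
      rw [Finset.mem_coe, Multiset.mem_toFinset, mem_roots h0, IsRoot.def]
      simp [hp, hc]
    · intro p hp p' hp' hpp
      simp only [Finset.coe_filter, Finset.mem_filter, Finset.mem_univ, true_and,
        Set.mem_ofPred_eq] at hp hp'
      exact Prod.ext (hp.2.trans hp'.2.symm) hpp

/-- Orthogonality in the multiplier c detects trace zero; removing c = 0 subtracts one for each x ≠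
0. -/
theorem sum_kloostermanSum_compTrace [DecidableEq L] [DecidableEq F] {ψ : AddChar F ℂ} (hψ : ψ ≠ 1)
    (a b : F) :
    ∑ c ∈ Finset.univ.erase (0 : F),
        kloostermanSum (ψ.compTrace L) (algebraMap F L (c * a)) (algebraMap F L (c * b))
      = Fintype.card F * (Finset.univ.filter fun x : L => x ≠ 0 ∧
        Algebra.trace F L (algebraMap F L a * x + algebraMap F L b * x⁻¹) = 0).card
        - (Fintype.card L - 1) := by
  simp only [kloostermanSum_eq_sum_ite]
  have key : ∀ x : L, (∑ c ∈ Finset.univ.erase (0 : F), if x = 0 then (0 : ℂ) else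
      ψ.compTrace L (algebraMap F L (c * a) * x + algebraMap F L (c * b) * x⁻¹))
      = Fintype.card F * (if x ≠ 0 ∧ Algebra.trace F L
        (algebraMap F L a * x + algebraMap F L b * x⁻¹) = 0 then 1 else 0)
        - (1 - if x = 0 then 1 else 0) := by
    intro x
    by_cases hx : x = 0
    · simp [hx]
    · simp only [hx, if_false, ne_eq, not_false_eq_true, true_and, sub_zero]
      rw [Finset.sum_erase_eq_sub (Finset.mem_univ _)]
      congr 1
      · rw [Finset.sum_congr rfl (g := fun c => ψ (c * Algebra.trace F L
          (algebraMap F L a * x + algebraMap F L b * x⁻¹)))]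
        · rw [AddChar.sum_mulShift _ (AddChar.IsPrimitive.of_ne_one hψ)]
          split_ifs <;> simp
        · intro c _
          have : algebraMap F L (c * a) * x + algebraMap F L (c * b) * x⁻¹
              = c • (algebraMap F L a * x + algebraMap F L b * x⁻¹) := by
            rw [Algebra.smul_def, map_mul, map_mul]
            ring
          rw [AddChar.compTrace_apply, this, map_smul, smul_eq_mul]
      · simp
  rw [Finset.sum_comm]
  rw [Finset.sum_congr rfl fun x _ => key x, Finset.sum_sub_distrib, ← Finset.mul_sum,
    Finset.sum_sub_distrib, Finset.sum_boole]
  simp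

theorem le_sum_kloostermanSum_compTrace [DecidableEq F] {ψ : AddChar F ℂ} (hψ : ψ ≠ 1)
    (hF : ringChar F ≠ 2) {a b : F} (ha : a ≠ 0)
    (hb : b ≠ 0) {r k : ℕ} (hrk : r = Fintype.card F ^ k) (hr : 2 * Fintype.card F + 2 ≤ r)
    (hL : Fintype.card L = r ^ 2) :
    -(8 * (Fintype.card F : ℝ) * r) ≤ ∑ c ∈ Finset.univ.erase (0 : F),
      (kloostermanSum (ψ.compTrace L) (algebraMap F L (c * a)) (algebraMap F L (c * b))).re := by
  classical
  have h1 := le_card_artinSchreier (L := L) hF ha hb hrk hr hL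
  have h2 := card_artinSchreier_le (L := L) a b
  have h3 := sum_kloostermanSum_compTrace (L := L) hψ a b
  have h4 := congrArg Complex.re h3
  rw [Complex.re_sum] at h4
  rw [h4]
  set Z := (Finset.univ.filter fun x : L => x ≠ 0 ∧
        Algebra.trace F L (algebraMap F L a * x + algebraMap F L b * x⁻¹) = 0).card
  have h5 : (r : ℝ) ^ 2 ≤ Fintype.card F * Z + 4 * Fintype.card F * r + 4 * Fintype.card F := by
    exact_mod_cast h1.trans (by omega)
  have hr1 : (1 : ℝ) ≤ r := by exact_mod_cast (by omega : 1 ≤ r)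
  have hqr : (Fintype.card F : ℝ) ≤ Fintype.card F * r :=
    le_mul_of_one_le_right (Nat.cast_nonneg _) hr1
  have h6 : (Fintype.card F * Z - (Fintype.card L - 1) : ℂ).re
      = (Fintype.card F : ℝ) * Z - ((r : ℝ) ^ 2 - 1) := by
    rw [hL]
    push_cast
    norm_cast
  rw [h6]
  linarith

end ArtinSchreier

/-! ### Weil's bound from the tower of quadratic extensions. -/

/-- If |u 0| exceeds 2, the excess is multiplied by at least 4 at each step, and 2 - u² then makes
the later terms negative without bound. Any one-sided bound, however weak, thus yields the sharp
constant 2. -/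
theorem abs_le_two_of_forall_neg_le {u : ℕ → ℝ} (hu : ∀ k, u (k + 1) = 2 - u k ^ 2) {B : ℝ}
    (hB : ∀ k, 2 ≤ k → -B ≤ u k) : |u 0| ≤ 2 := by
  by_contra! h
  set s := |u 0| - 2 with hs
  have hs0 : 0 < s := by linarith
  have grow : ∀ k, 2 + 4 ^ k * s ≤ |u k| := by
    intro k
    induction k with
    | zero => simp [hs]
    | succ k ih =>
      have ht : 0 < 4 ^ k * s := by positivity
      have h1 : (2 + 4 ^ k * s) ^ 2 ≤ u k ^ 2 := by
        rw [← sq_abs (u k)]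
        exact pow_le_pow_left₀ (by linarith) ih 2
      rw [hu, abs_sub_comm]
      refine le_trans ?_ (le_abs_self _)
      rw [pow_succ]
      nlinarith
  obtain ⟨n, hn⟩ := pow_unbounded_of_one_lt (B / s) (by norm_num : (1 : ℝ) < 4)
  rw [div_lt_iff₀ hs0] at hn
  have h4 : (4 : ℝ) ^ n ≤ 4 ^ (n + 1) := pow_le_pow_right₀ (by norm_num) (by omega)
  have h1 := grow (n + 1)
  have h2 := hB (n + 2) (by omega)
  rw [hu] at h2
  have ht : 0 < (4 : ℝ) ^ (n + 1) * s := by positivity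
  have h3 : (2 + 4 ^ (n + 1) * s) ^ 2 ≤ u (n + 1) ^ 2 := by
    rw [← sq_abs (u _)]
    exact pow_le_pow_left₀ (by linarith) h1 2
  nlinarith

/-- The values of a Kloosterman sum in the tower of quadratic extensions over a field with `q`
elements, in terms of its value `z` over that field. -/
def kloostermanTower (q z : ℝ) : ℕ → ℝ
  | 0 => z
  | k + 1 => 2 * q ^ 2 ^ k - kloostermanTower q z k ^ 2

theorem AddChar.compTrace_ne_one {F : Type*} [Field F] [Fintype F] {ψ : AddChar F ℂ} (hψ : ψ ≠ 1)
    (L : Type*) [Field L] [Fintype L] [Algebra F L] : ψ.compTrace L ≠ 1 := by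
  obtain ⟨x, hx⟩ := AddChar.ne_one_iff.1 hψ
  obtain ⟨y, hy⟩ := Algebra.trace_surjective F L x
  exact AddChar.ne_one_iff.2 ⟨y, by rwa [AddChar.compTrace_apply, hy]⟩

theorem kloostermanSum_quadratic_re {F L : Type*} [Field F] [Fintype F] [Field L] [Fintype L]
    [Algebra F L] (hF : ringChar F ≠ 2) (hL : Fintype.card L = Fintype.card F ^ 2)
    {ψ : AddChar F ℂ} (hψ : ψ ≠ 1) {a b : F} (ha : a ≠ 0) (hb : b ≠ 0) :
    (kloostermanSum (ψ.compTrace L) (algebraMap F L a) (algebraMap F L b)).re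
      = 2 * Fintype.card F - (kloostermanSum ψ a b).re ^ 2 := by
  rw [kloostermanSum_quadratic hF hL hψ ha hb, Complex.sub_re, sq (kloostermanSum ψ a b),
    Complex.mul_re (kloostermanSum ψ a b), kloostermanSum_im]
  simp [sq]

theorem FiniteField.exists_quadratic_extension (F : Type*) [Field F] [Fintype F] :
    ∃ (L : Type) (_ : Field L) (_ : Fintype L) (_ : Algebra F L),
      Fintype.card L = Fintype.card F ^ 2 := by
  obtain ⟨p, hp⟩ := CharP.exists F
  have : Fact p.Prime := ⟨CharP.char_is_prime F p⟩
  refine ⟨FiniteField.Extension F p 2, inferInstance, Fintype.ofFinite _, inferInstance, ?_⟩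
  have h := FiniteField.natCard_extension F p 2
  rwa [@Nat.card_eq_fintype_card _ (Fintype.ofFinite _), Nat.card_eq_fintype_card] at h

/-- Levels start at k + 1 because the extensions live in `Type`, whereas F may lie in another
universe. -/
theorem exists_kloostermanTower {F : Type*} [Field F] [Fintype F] (hF : ringChar F ≠ 2)
    {ψ : AddChar F ℂ} (hψ : ψ ≠ 1) (k : ℕ) :
    ∃ (L : Type) (_ : Field L) (_ : Fintype L) (_ : Algebra F L),
      Fintype.card L = Fintype.card F ^ 2 ^ (k + 1) ∧ ∀ a b : F, a ≠ 0 → b ≠ 0 →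
        (kloostermanSum (ψ.compTrace L) (algebraMap F L a) (algebraMap F L b)).re
          = kloostermanTower (Fintype.card F) (kloostermanSum ψ a b).re (k + 1) := by
  induction k with
  | zero =>
    obtain ⟨L, i1, i2, i3, hL⟩ := FiniteField.exists_quadratic_extension F
    refine ⟨L, i1, i2, i3, by simpa using hL, fun a b ha hb => ?_⟩
    rw [kloostermanSum_quadratic_re hF hL hψ ha hb]
    simp [kloostermanTower]
  | succ k ih =>
    obtain ⟨L, i1, i2, i3, hL, hK⟩ := ih
    obtain ⟨M, j1, j2, j3, hM⟩ := FiniteField.exists_quadratic_extension L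
    let : Algebra F M := ((algebraMap L M).comp (algebraMap F L)).toAlgebra
    have : IsScalarTower F L M := IsScalarTower.of_algebraMap_eq' rfl
    refine ⟨M, j1, j2, inferInstance, ?_, fun a b ha hb => ?_⟩
    · rw [hM, hL, ← pow_mul, ← pow_succ]
    · have hcomp : ψ.compTrace M = (ψ.compTrace L).compTrace M := by
        ext x
        rw [AddChar.compTrace_apply, AddChar.compTrace_apply, AddChar.compTrace_apply,
          Algebra.trace_trace]
      have hchar : ringChar L ≠ 2 := by rwa [← Algebra.ringChar_eq F L]
      rw [hcomp, IsScalarTower.algebraMap_apply F L M, IsScalarTower.algebraMap_apply F L M,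
        kloostermanSum_quadratic_re hchar hM (AddChar.compTrace_ne_one hψ L) (by simpa using ha)
          (by simpa using hb), hK a b ha hb, hL]
      conv_rhs => rw [kloostermanTower]
      push_cast
      rfl

/-- **Weil's bound** for Kloosterman sums. -/
theorem abs_kloostermanSum_re_le {F : Type*} [Field F] [Fintype F] (hF : ringChar F ≠ 2)
    {ψ : AddChar F ℂ} (hψ : ψ ≠ 1) {a b : F} (ha : a ≠ 0) (hb : b ≠ 0) :
    |(kloostermanSum ψ a b).re| ≤ 2 * √(Fintype.card F) := by
  classical
  set q := Fintype.card F with hq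
  have hq3 : 3 ≤ q := by
    have := FiniteField.odd_card_of_char_ne_two hF
    have := Fintype.one_lt_card (α := F)
    omega
  have hqR : (3 : ℝ) ≤ q := by exact_mod_cast hq3
  have hs0 : 0 < √(q : ℝ) := Real.sqrt_pos.2 (by linarith)
  have hsq : √(q : ℝ) ^ 2 = q := Real.sq_sqrt (by linarith)
  have hpow : ∀ k, √(q : ℝ) ^ 2 ^ (k + 1) = (q : ℝ) ^ 2 ^ k := fun k => by
    rw [pow_succ', pow_mul, hsq]
  set κ : F → F → ℕ → ℝ := fun a b => kloostermanTower q (kloostermanSum ψ a b).re with hκ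
  have hupper : ∀ a b k, κ a b (k + 1) ≤ 2 * (q : ℝ) ^ 2 ^ k := fun a b k => by
    simp only [hκ, kloostermanTower]
    linarith [sq_nonneg (kloostermanTower q (kloostermanSum ψ a b).re k)]
  -- Stepanov's bound controls only the sum over all multipliers c. The term c = 1 is isolated with
  -- the upper bound 2q^(2^k), which the recursion gives for every other term: 8q + 2q = 10q.
  have hlower : ∀ k, 1 ≤ k → -(10 * q) * (q : ℝ) ^ 2 ^ k ≤ κ a b (k + 1) := by
    intro k hk
    obtain ⟨L, i1, i2, i3, hL, hK⟩ := exists_kloostermanTower hF hψ k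
    rw [← hq] at hL hK
    have hr : 2 * q + 2 ≤ q ^ 2 ^ k := by
      have h1 : q ^ 2 ≤ q ^ 2 ^ k := Nat.pow_le_pow_right (by omega) (by
        calc 2 = 2 ^ 1 := rfl
          _ ≤ 2 ^ k := Nat.pow_le_pow_right (by omega) hk)
      nlinarith
    have hS := le_sum_kloostermanSum_compTrace (L := L) hψ hF ha hb (r := q ^ 2 ^ k) rfl hr
      (by rw [hL, pow_succ, pow_mul])
    rw [← hq, Finset.sum_congr rfl (g := fun c => κ (c * a) (c * b) (k + 1))
      (fun c hc => hK _ _ (mul_ne_zero (Finset.ne_of_mem_erase hc) ha)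
        (mul_ne_zero (Finset.ne_of_mem_erase hc) hb)),
      ← Finset.sum_erase_add _ _ (a := 1) (by simp)] at hS
    have hrest : ∑ c ∈ (Finset.univ.erase (0 : F)).erase 1, κ (c * a) (c * b) (k + 1)
        ≤ q * (2 * (q : ℝ) ^ 2 ^ k) := by
      refine (Finset.sum_le_card_nsmul _ _ _ fun c _ => hupper _ _ _).trans ?_
      rw [nsmul_eq_mul]
      refine mul_le_mul_of_nonneg_right ?_ (by positivity)
      exact_mod_cast Finset.card_le_univ _
    simp only [one_mul] at hS
    push_cast at hS
    linarith
  have := abs_le_two_of_forall_neg_le (u := fun k => κ a b k / √(q : ℝ) ^ 2 ^ k) (B := 10 * q)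
    (fun k => by
      rw [hpow, div_pow, ← pow_mul, ← pow_succ, hpow]
      have : (0 : ℝ) < (q : ℝ) ^ 2 ^ k := by positivity
      field_simp
      simp [hκ, kloostermanTower, mul_comm])
    (fun k hk => by
      obtain ⟨j, rfl⟩ : ∃ j, k = j + 1 := ⟨k - 1, by omega⟩
      rw [hpow, le_div_iff₀ (by positivity)]
      exact hlower j (by omega))
  simp only [pow_zero, pow_one] at this
  rwa [abs_div, abs_of_pos hs0, div_le_iff₀ hs0] at this

theorem kloostermanSum_zero_right {F : Type*} [Field F] [Fintype F] {ψ : AddChar F ℂ} (hψ : ψ ≠ 1)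
    {a : F} (ha : a ≠ 0) : kloostermanSum ψ a 0 = -1 := by
  classical
  have h := AddChar.sum_mulShift a (AddChar.IsPrimitive.of_ne_one hψ)
  rw [if_neg ha, Nat.cast_zero] at h
  rw [kloostermanSum_eq_sum_ite, ← Finset.sum_erase_add _ _ (Finset.mem_univ (0 : F))]
  rw [← Finset.sum_erase_add _ _ (Finset.mem_univ (0 : F))] at h
  rw [if_pos rfl, add_zero, Finset.sum_congr rfl (g := fun x => ψ (x * a))]
  · simp only [zero_mul, AddChar.map_zero_eq_one] at h
    linear_combination h
  · intro x hx
    rw [if_neg (Finset.ne_of_mem_erase hx)]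
    congr 1
    ring

theorem norm_kloostermanSum_le {F : Type*} [Field F] [Fintype F] (hF : ringChar F ≠ 2)
    {ψ : AddChar F ℂ} (hψ : ψ ≠ 1) {a : F} (ha : a ≠ 0) (b : F) :
    ‖kloostermanSum ψ a b‖ ≤ 2 * √(Fintype.card F) := by
  by_cases hb : b = 0
  · rw [hb, kloostermanSum_zero_right hψ ha, norm_neg, norm_one]
    have : 1 ≤ √(Fintype.card F : ℝ) := by
      rw [Real.one_le_sqrt]
      exact_mod_cast Fintype.card_pos
    linarith
  · have h : kloostermanSum ψ a b = ((kloostermanSum ψ a b).re : ℂ) :=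
      Complex.ext rfl (by rw [kloostermanSum_im, Complex.ofReal_im])
    rw [h, Complex.norm_real]
    exact abs_kloostermanSum_re_le hF hψ ha hb

/-! ### Fourier analysis on the plane and the transform of a circle. -/

section PlaneFourier

open Finset

variable {F : Type*} [Field F] [Fintype F]

/-- The Fourier transform on the plane `F²` with respect to the additive character `ψ`. -/
noncomputable def planeFourier (ψ : AddChar F ℂ) (f : (Fin 2 → F) → ℂ) (ξ : Fin 2 → F) : ℂ :=
  ∑ x, f x * ψ (ξ ⬝ᵥ x)

theorem planeFourier_zero (ψ : AddChar F ℂ) (f : (Fin 2 → F) → ℂ) :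
    planeFourier ψ f 0 = ∑ x, f x := by
  simp [planeFourier]

variable [DecidableEq F]

theorem sum_addChar_dotProduct {ψ : AddChar F ℂ} (hψ : ψ ≠ 1) (x : Fin 2 → F) :
    ∑ ξ : Fin 2 → F, ψ (ξ ⬝ᵥ x) = if x = 0 then (Fintype.card F : ℂ) ^ 2 else 0 := by
  split_ifs with hx
  · simp [hx]
  · let φ : (Fin 2 → F) →+ F :=
      { toFun := fun ξ => ξ ⬝ᵥ x
        map_zero' := zero_dotProduct x
        map_add' := fun ξ η => add_dotProduct ξ η x }
    refine AddChar.sum_eq_zero_of_ne_one (ψ := ψ.compAddMonoidHom φ) ?_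
    obtain ⟨y, hy⟩ := AddChar.ne_one_iff.1 hψ
    obtain ⟨i, hi⟩ := Function.ne_iff.1 hx
    refine AddChar.ne_one_iff.2 ⟨Pi.single i (y / x i), ?_⟩
    change ψ (Pi.single i (y / x i) ⬝ᵥ x) ≠ 1
    rwa [single_dotProduct, div_mul_cancel₀ _ hi]

/-- Parseval's identity. -/
theorem sum_norm_sq_planeFourier {ψ : AddChar F ℂ} (hψ : ψ ≠ 1) (f : (Fin 2 → F) → ℂ) :
    ∑ ξ, ‖planeFourier ψ f ξ‖ ^ 2 = (Fintype.card F : ℝ) ^ 2 * ∑ x, ‖f x‖ ^ 2 := by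
  have h : ∀ z : ℂ, ((‖z‖ ^ 2 : ℝ) : ℂ) = z * (starRingEnd ℂ) z := fun z => by
    rw [Complex.mul_conj, Complex.normSq_eq_norm_sq]
  apply Complex.ofReal_injective
  rw [Complex.ofReal_sum, Complex.ofReal_mul, Complex.ofReal_sum]
  simp only [h]
  calc ∑ ξ, planeFourier ψ f ξ * (starRingEnd ℂ) (planeFourier ψ f ξ)
      = ∑ ξ, ∑ x, ∑ y, f x * (starRingEnd ℂ) (f y) * ψ (ξ ⬝ᵥ (x - y)) := by
        refine sum_congr rfl fun ξ _ => ?_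
        rw [planeFourier, map_sum, sum_mul_sum]
        refine sum_congr rfl fun x _ => sum_congr rfl fun y _ => ?_
        rw [map_mul, ← AddChar.map_neg_eq_conj, dotProduct_sub, sub_eq_add_neg,
          AddChar.map_add_eq_mul]
        ring
    _ = ∑ x, ∑ y, f x * (starRingEnd ℂ) (f y) * ∑ ξ, ψ (ξ ⬝ᵥ (x - y)) := by
        rw [sum_comm]
        refine sum_congr rfl fun x _ => ?_
        rw [sum_comm]
        simp only [mul_sum]
    _ = _ := by
        simp only [sum_addChar_dotProduct hψ, sub_eq_zero]
        simp only [mul_ite, mul_zero, sum_ite_eq, mem_univ, if_true, mul_sum]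
        refine sum_congr rfl fun x _ => ?_
        push_cast
        ring

/-- The variance of `f` is the Fourier mass away from the origin. -/
theorem card_sq_mul_variance {ψ : AddChar F ℂ} (hψ : ψ ≠ 1) (f : (Fin 2 → F) → ℂ) :
    (Fintype.card F : ℝ) ^ 2 * ∑ x, ‖f x - (∑ y, f y) / (Fintype.card F : ℂ) ^ 2‖ ^ 2
      = ∑ ξ ∈ univ.erase 0, ‖planeFourier ψ f ξ‖ ^ 2 := by
  rw [← sum_norm_sq_planeFourier hψ, ← sum_erase_add _ _ (mem_univ (0 : Fin 2 → F))]
  have hq : (Fintype.card F : ℂ) ≠ 0 := by exact_mod_cast Fintype.card_ne_zero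
  have h : ∀ ξ, planeFourier ψ (fun x => f x - (∑ y, f y) / (Fintype.card F : ℂ) ^ 2) ξ
      = planeFourier ψ f ξ - (∑ y, f y) / (Fintype.card F : ℂ) ^ 2
        * if ξ = 0 then (Fintype.card F : ℂ) ^ 2 else 0 := by
    intro ξ
    rw [← sum_addChar_dotProduct hψ, mul_sum, planeFourier, planeFourier, ← sum_sub_distrib]
    refine sum_congr rfl fun x _ => ?_
    rw [sub_mul, dotProduct_comm x]
  have h0 : planeFourier ψ (fun x => f x - (∑ y, f y) / (Fintype.card F : ℂ) ^ 2) 0 = 0 := by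
    rw [h, if_pos rfl, planeFourier_zero, div_mul_cancel₀ _ (pow_ne_zero 2 hq), sub_self]
  rw [h0, norm_zero, zero_pow two_ne_zero, add_zero]
  refine sum_congr rfl fun ξ hξ => ?_
  rw [h, if_neg (ne_of_mem_erase hξ), mul_zero, sub_zero]

omit [DecidableEq F] in
theorem planeFourier_convolution (ψ : AddChar F ℂ) (f g : (Fin 2 → F) → ℂ) (ξ : Fin 2 → F) :
    planeFourier ψ (fun x => ∑ y, f y * g (x - y)) ξ = planeFourier ψ f ξ * planeFourier ψ g ξ := by
  unfold planeFourier
  rw [sum_mul_sum]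
  simp only [sum_mul]
  rw [sum_comm]
  refine sum_congr rfl fun y _ => ?_
  refine Fintype.sum_equiv (Equiv.subRight y) _ _ fun x => ?_
  simp only [Equiv.subRight_apply]
  rw [dotProduct_sub, mul_mul_mul_comm, ← AddChar.map_add_eq_mul, add_sub_cancel]

omit [Field F] [DecidableEq F] in
theorem sum_plane (φ : F → F → ℂ) : ∑ x : Fin 2 → F, φ (x 0) (x 1) = ∑ a, ∑ b, φ a b := by
  rw [← Fintype.sum_prod_type']
  exact Fintype.sum_equiv (finTwoArrowEquiv F) _ _ fun x => rfl

/-- The sum of a quadratic phase over the plane. -/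
theorem sum_plane_quadratic {ψ : AddChar F ℂ} (hψ : ψ ≠ 1) (hF : ringChar F ≠ 2) {s : F}
    (hs : s ≠ 0) (ξ : Fin 2 → F) :
    ∑ x : Fin 2 → F, ψ (s * planeNorm x + ξ ⬝ᵥ x)
      = (quadraticChar F (-1) : ℤ) * Fintype.card F * ψ (-(planeNorm ξ / 4) * s⁻¹) := by
  have h2 : (2 : F) ≠ 0 := Ring.two_ne_zero hF
  have h4 : (4 : F) ≠ 0 := by rw [show (4 : F) = 2 ^ 2 by norm_num]; exact pow_ne_zero 2 h2
  set χ : MulChar F ℂ := (quadraticChar F).ringHomComp (Int.castRingHom ℂ) with hχ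
  have hχapp : ∀ a, χ a = (quadraticChar F a : ℤ) := fun a => rfl
  have hG : ∑ y : F, ψ (s * y ^ 2) = (quadraticChar F s : ℤ) * gaussSum χ ψ := by
    rw [sum_sq_eq_sum_quadraticChar hF (fun m => ψ (s * m))]
    have h0 : ∑ m, ψ (s * m) = 0 := by
      have := AddChar.sum_mulShift s (AddChar.IsPrimitive.of_ne_one hψ)
      rw [if_neg hs, Nat.cast_zero] at this
      rw [← this]
      exact sum_congr rfl fun m _ => by rw [mul_comm]
    simp only [add_mul, one_mul, sum_add_distrib, h0, add_zero]
    rw [gaussSum, mul_sum]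
    refine Fintype.sum_equiv (Equiv.mulLeft₀ s hs) _ _ fun m => ?_
    rw [Equiv.mulLeft₀_apply, hχapp, map_mul (quadraticChar F)]
    have : ((quadraticChar F s : ℤ) : ℂ) ^ 2 = 1 := by
      exact_mod_cast quadraticChar_sq_one hs
    push_cast
    linear_combination (-(quadraticChar F m : ℤ) * ψ (s * m) : ℂ) * this
  -- Completing the square reduces to a quadratic Gauss sum.
  have hone : ∀ c : F, ∑ y : F, ψ (s * y ^ 2 + c * y)
      = ψ (-(c ^ 2 / 4) * s⁻¹) * ((quadraticChar F s : ℤ) * gaussSum χ ψ) := by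
    intro c
    rw [← hG, mul_sum]
    refine Fintype.sum_equiv (Equiv.addRight (c / (2 * s))) _ _ fun y => ?_
    rw [Equiv.coe_addRight, ← AddChar.map_add_eq_mul]
    congr 1
    field_simp
    ring
  -- The plane contributes two Gauss sums, so the factor χ(s) appears squared and disappears. This
  -- is why circles lead to Kloosterman sums without a character twist.
  have hsq : gaussSum χ ψ ^ 2 = (quadraticChar F (-1) : ℤ) * Fintype.card F :=
    gaussSum_sq ((MulChar.ringHomComp_ne_one_iff Int.cast_injective).2 (quadraticChar_ne_one hF))
      ((quadraticChar_isQuadratic F).comp _) (AddChar.IsPrimitive.of_ne_one hψ)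
  calc ∑ x : Fin 2 → F, ψ (s * planeNorm x + ξ ⬝ᵥ x)
      = ∑ x : Fin 2 → F, ψ (s * x 0 ^ 2 + ξ 0 * x 0) * ψ (s * x 1 ^ 2 + ξ 1 * x 1) := by
        refine sum_congr rfl fun x _ => ?_
        rw [← AddChar.map_add_eq_mul, planeNorm, dotProduct, Fin.sum_univ_two]
        congr 1
        ring
    _ = (∑ y : F, ψ (s * y ^ 2 + ξ 0 * y)) * ∑ y : F, ψ (s * y ^ 2 + ξ 1 * y) := by
        rw [sum_plane (fun a b => ψ (s * a ^ 2 + ξ 0 * a) * ψ (s * b ^ 2 + ξ 1 * b)), sum_mul_sum]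
    _ = _ := by
        rw [hone, hone, ← hsq]
        have h1 : ((quadraticChar F s : ℤ) : ℂ) ^ 2 = 1 := by
          exact_mod_cast quadraticChar_sq_one hs
        have h3 : ψ (-(planeNorm ξ / 4) * s⁻¹)
            = ψ (-(ξ 0 ^ 2 / 4) * s⁻¹) * ψ (-(ξ 1 ^ 2 / 4) * s⁻¹) := by
          rw [← AddChar.map_add_eq_mul, planeNorm]
          congr 1
          ring
        rw [h3]
        linear_combination (ψ (-(ξ 0 ^ 2 / 4) * s⁻¹) * ψ (-(ξ 1 ^ 2 / 4) * s⁻¹)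
          * gaussSum χ ψ ^ 2) * h1

/-- The Fourier transform of a circle is a Kloosterman sum. -/
theorem planeFourier_circle {ψ : AddChar F ℂ} (hψ : ψ ≠ 1) (hF : ringChar F ≠ 2) (t : F)
    (ξ : Fin 2 → F) :
    planeFourier ψ (fun x => if planeNorm x = t then 1 else 0) ξ
      = (if ξ = 0 then (Fintype.card F : ℂ) else 0)
        + (quadraticChar F (-1) : ℤ) * kloostermanSum ψ (-t) (-(planeNorm ξ / 4)) := by
  have hq : (Fintype.card F : ℂ) ≠ 0 := by exact_mod_cast Fintype.card_ne_zero
  apply mul_left_cancel₀ hq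
  calc (Fintype.card F : ℂ) * planeFourier ψ (fun x => if planeNorm x = t then 1 else 0) ξ
      = ∑ x : Fin 2 → F, ∑ s : F, ψ (s * (planeNorm x - t)) * ψ (ξ ⬝ᵥ x) := by
        rw [planeFourier, mul_sum]
        refine sum_congr rfl fun x _ => ?_
        rw [← sum_mul, AddChar.sum_mulShift _ (AddChar.IsPrimitive.of_ne_one hψ)]
        simp only [sub_eq_zero]
        split_ifs <;> simp
    _ = ∑ s : F, ψ (s * -t) * ∑ x : Fin 2 → F, ψ (s * planeNorm x + ξ ⬝ᵥ x) := by
        rw [sum_comm]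
        refine sum_congr rfl fun s _ => ?_
        rw [mul_sum]
        refine sum_congr rfl fun x _ => ?_
        rw [← AddChar.map_add_eq_mul, ← AddChar.map_add_eq_mul]
        congr 1
        ring
    _ = _ := by
        -- The term s = 0 is the mass at the zero frequency; the terms s ≠ 0 assemble into the
        -- Kloosterman sum.
        rw [← sum_erase_add _ _ (mem_univ (0 : F)), kloostermanSum_eq_sum_ite,
          ← sum_erase_add _ _ (mem_univ (0 : F)), if_pos rfl, add_zero]
        have h0 : ∑ x : Fin 2 → F, ψ (0 * planeNorm x + ξ ⬝ᵥ x)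
            = if ξ = 0 then (Fintype.card F : ℂ) ^ 2 else 0 := by
          rw [← sum_addChar_dotProduct hψ]
          exact sum_congr rfl fun x _ => by rw [zero_mul, zero_add, dotProduct_comm]
        rw [h0, zero_mul, AddChar.map_zero_eq_one, one_mul, mul_add, add_comm]
        congr 1
        · split_ifs
          · ring
          · simp
        · rw [← mul_assoc, mul_sum]
          refine sum_congr rfl fun s hs => ?_
          have hs := ne_of_mem_erase hs
          rw [sum_plane_quadratic hψ hF hs, if_neg hs, AddChar.map_add_eq_mul, mul_comm s]
          ring

theorem norm_quadraticChar_neg_one : ‖((quadraticChar F (-1) : ℤ) : ℂ)‖ = 1 := by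
  rcases quadraticChar_dichotomy (F := F) (neg_ne_zero.2 one_ne_zero) with h | h <;> simp [h]

/-- Nonzero isotropic ξ are included: there the Kloosterman sum degenerates to -1. The condition t ≠
0 keeps its first parameter nonzero. -/
theorem norm_planeFourier_circle_le {ψ : AddChar F ℂ} (hψ : ψ ≠ 1) (hF : ringChar F ≠ 2) {t : F}
    (ht : t ≠ 0) {ξ : Fin 2 → F} (hξ : ξ ≠ 0) :
    ‖planeFourier ψ (fun x => if planeNorm x = t then 1 else 0) ξ‖ ≤ 2 * √(Fintype.card F) := by
  rw [planeFourier_circle hψ hF, if_neg hξ, zero_add, norm_mul, norm_quadraticChar_neg_one, one_mul]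
  exact norm_kloostermanSum_le hF hψ (neg_ne_zero.2 ht) _

end PlaneFourier

/-! ### Variance of circle counts and of incidences under rigid motions. -/

noncomputable instance SO2.fintype (F : Type*) [Field F] [Fintype F] : Fintype (SO2 F) :=
  Fintype.ofFinite _

noncomputable instance RigidMotion.fintype (F : Type*) [Field F] [Fintype F] :
    Fintype (RigidMotion F) :=
  Fintype.ofEquiv _ SemidirectProduct.equivProd.symm

section PlaneCounting

open Finset

variable {F : Type*} [Field F] [Fintype F] [DecidableEq F]

/-- The number of points of `E` at distance `t` from `x`. -/
def circleDegree (E : Finset (Fin 2 → F)) (t : F) (x : Fin 2 → F) : ℕ :=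
  #{y ∈ E | planeNorm (x - y) = t}

theorem exists_addChar_ne_one (F : Type*) [Field F] [Fintype F] : ∃ ψ : AddChar F ℂ, ψ ≠ 1 := by
  obtain ⟨ψ, hψ⟩ := AddChar.exists_apply_ne_zero.2 (one_ne_zero (α := F))
  exact ⟨ψ, AddChar.ne_one_iff.2 ⟨1, hψ⟩⟩

theorem abs_card_circle_sub_le (hF : ringChar F ≠ 2) {t : F} (ht : t ≠ 0) :
    |(#{x : Fin 2 → F | planeNorm x = t} : ℝ) - Fintype.card F| ≤ 1 := by
  obtain ⟨ψ, hψ⟩ := exists_addChar_ne_one F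
  have h := planeFourier_circle hψ hF t 0
  rw [planeFourier_zero, if_pos rfl, sum_boole] at h
  have h0 : -(planeNorm (0 : Fin 2 → F) / 4) = 0 := by simp [planeNorm]
  rw [h0, kloostermanSum_zero_right hψ (neg_ne_zero.2 ht)] at h
  have h1 : (((#{x : Fin 2 → F | planeNorm x = t} : ℝ) - Fintype.card F : ℝ) : ℂ)
      = -(quadraticChar F (-1) : ℤ) := by
    push_cast
    rw [h]
    ring
  rw [← Real.norm_eq_abs, ← Complex.norm_real, h1, norm_neg, norm_quadraticChar_neg_one]

theorem sum_norm_sq_planeFourier_indicator {ψ : AddChar F ℂ} (hψ : ψ ≠ 1)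
    (E : Finset (Fin 2 → F)) :
    ∑ ξ, ‖planeFourier ψ (fun x => if x ∈ E then 1 else 0) ξ‖ ^ 2
      = (Fintype.card F : ℝ) ^ 2 * #E := by
  rw [sum_norm_sq_planeFourier hψ]
  congr 1
  have : ∀ x : Fin 2 → F, ‖(if x ∈ E then 1 else 0 : ℂ)‖ ^ 2 = if x ∈ E then (1 : ℝ) else 0 := by
    intro x
    split_ifs <;> simp
  simp only [this, sum_boole]
  simp

/-- The variance of the number of points of `E` on a circle of radius `t` about a random centre. -/
theorem sum_circleDegree_sub_sq_le (hF : ringChar F ≠ 2) {t : F} (ht : t ≠ 0)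
    (E : Finset (Fin 2 → F)) :
    ∑ x, ((circleDegree E t x : ℝ)
      - #E * #{x : Fin 2 → F | planeNorm x = t} / (Fintype.card F : ℝ) ^ 2) ^ 2
      ≤ 4 * Fintype.card F * #E := by
  obtain ⟨ψ, hψ⟩ := exists_addChar_ne_one F
  have hq : (0 : ℝ) < Fintype.card F := by exact_mod_cast Fintype.card_pos
  set f : (Fin 2 → F) → ℂ := fun x => if x ∈ E then 1 else 0 with hf
  set g : (Fin 2 → F) → ℂ := fun x => if planeNorm x = t then 1 else 0 with hg
  -- The degree is the convolution of E with the circle, so its nonzero frequencies are those of E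
  -- times O(√q).
  have hconv : ∀ x, ∑ y, f y * g (x - y) = (circleDegree E t x : ℂ) := by
    intro x
    rw [circleDegree, ← filter_univ_mem E, filter_filter, ← sum_boole]
    refine sum_congr rfl fun y _ => ?_
    simp only [hf, hg, ite_and]
    split_ifs <;> simp
  have hsum : ∑ x, (circleDegree E t x : ℂ) = #E * #{x : Fin 2 → F | planeNorm x = t} := by
    simp only [← hconv]
    rw [← planeFourier_zero ψ, planeFourier_convolution, planeFourier_zero, planeFourier_zero]
    simp [hf, hg]
  have hvar := card_sq_mul_variance hψ (fun x => (circleDegree E t x : ℂ))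
  rw [hsum] at hvar
  have hcast : ∀ x, ‖(circleDegree E t x : ℂ) - #E * #{x : Fin 2 → F | planeNorm x = t}
      / (Fintype.card F : ℂ) ^ 2‖ ^ 2 = ((circleDegree E t x : ℝ)
      - #E * #{x : Fin 2 → F | planeNorm x = t} / (Fintype.card F : ℝ) ^ 2) ^ 2 := by
    intro x
    rw [← sq_abs (_ - _ : ℝ), ← Real.norm_eq_abs, ← Complex.norm_real]
    push_cast
    rfl
  simp only [hcast] at hvar
  refine le_of_mul_le_mul_left (hvar.le.trans ?_) (pow_pos hq 2)
  calc ∑ ξ ∈ univ.erase 0, ‖planeFourier ψ (fun x => (circleDegree E t x : ℂ)) ξ‖ ^ 2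
      ≤ ∑ ξ ∈ univ.erase 0, ‖planeFourier ψ f ξ‖ ^ 2 * (4 * Fintype.card F) := by
        refine sum_le_sum fun ξ hξ => ?_
        simp only [← hconv]
        rw [planeFourier_convolution, norm_mul, mul_pow]
        refine mul_le_mul_of_nonneg_left ?_ (sq_nonneg _)
        refine (pow_le_pow_left₀ (norm_nonneg _)
          (norm_planeFourier_circle_le hψ hF ht (ne_of_mem_erase hξ)) 2).trans ?_
        rw [mul_pow, Real.sq_sqrt hq.le]
        norm_num
    _ ≤ ∑ ξ, ‖planeFourier ψ f ξ‖ ^ 2 * (4 * Fintype.card F) :=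
        sum_le_sum_of_subset_of_nonneg (erase_subset _ _) fun _ _ _ => by positivity
    _ = _ := by
        rw [← sum_mul, sum_norm_sq_planeFourier_indicator hψ]
        ring

omit [Fintype F] [DecidableEq F] in
/-- A rotation is determined by the image of a nonzero vector. -/
theorem rotation_unique {a b a' b' x y : F} (h : a ^ 2 + b ^ 2 = 1) (h' : a' ^ 2 + b' ^ 2 = 1)
    (hxy : ¬(x = 0 ∧ y = 0)) (hF : (2 : F) ≠ 0) (h1 : a * x - b * y = a' * x - b' * y)
    (h2 : b * x + a * y = b' * x + a' * y) : a = a' ∧ b = b' := by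
  -- When -1 is a square this alone does not give equality; the unit norms are needed to rule out an
  -- isotropic difference.
  have h3 : (a - a') ^ 2 + (b - b') ^ 2 = 0 := by
    by_cases hx : x = 0
    · have hy : y ≠ 0 := fun hy => hxy ⟨hx, hy⟩
      refine (mul_eq_zero.1 (?_ : y * _ = 0)).resolve_left hy
      linear_combination (b' - b) * h1 + (a - a') * h2
    · refine (mul_eq_zero.1 (?_ : x * _ = 0)).resolve_left hx
      linear_combination (a - a') * h1 + (b - b') * h2
  have hc : a * a' + b * b' = 1 := by
    apply mul_left_cancel₀ hF
    linear_combination h + h' - h3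
  have hd : a * b' - a' * b = 0 := by
    apply pow_eq_zero_iff two_ne_zero |>.1
    linear_combination (a ^ 2 + b ^ 2) * h' + h - (a * a' + b * b' + 1) * hc
  constructor
  · linear_combination -a * h' + a' * hc + b' * hd
  · linear_combination -b * h' + b' * hc - a' * hd

omit [Fintype F] [DecidableEq F] in
theorem SO2.entries (h : SO2 F) : h.1 0 0 = h.1 1 1 ∧ h.1 0 1 = -h.1 1 0 ∧
    h.1 1 1 ^ 2 + h.1 1 0 ^ 2 = 1 := by
  obtain ⟨h1, h2, h3⟩ := Matrix.mem_specialOrthogonalGroup_fin_two_iff.1 h.2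
  refine ⟨h1, h2, ?_⟩
  rw [h1, h2] at h3
  linear_combination h3

omit [Fintype F] [DecidableEq F] in
theorem SO2.ext_of_entries {h h' : SO2 F} (h1 : h.1 1 1 = h'.1 1 1) (h2 : h.1 1 0 = h'.1 1 0) :
    h = h' := by
  have e := SO2.entries h
  have e' := SO2.entries h'
  apply Subtype.ext
  ext i j
  fin_cases i <;> fin_cases j
  · exact (e.1.trans h1).trans e'.1.symm
  · exact (e.2.1.trans (by rw [h2])).trans e'.2.1.symm
  · exact h2
  · exact h1

omit [Fintype F] [DecidableEq F] in
theorem SO2.eq_of_mulVec_eq (hF : (2 : F) ≠ 0) {h h' : SO2 F} {x : Fin 2 → F} (hx : x ≠ 0)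
    (hh : Matrix.mulVec h.1 x = Matrix.mulVec h'.1 x) : h = h' := by
  have e := SO2.entries h
  have e' := SO2.entries h'
  have h0 := congrFun hh 0
  have h1 := congrFun hh 1
  simp only [Matrix.mulVec, dotProduct, Fin.sum_univ_two, e.1, e'.1, e.2.1, e'.2.1] at h0 h1
  obtain ⟨k1, k2⟩ := rotation_unique e.2.2 e'.2.2 (x := x 0) (y := x 1)
    (fun h => hx (by ext i; fin_cases i; exacts [h.1, h.2])) hF
    (by linear_combination h0) (by linear_combination h1)
  exact SO2.ext_of_entries k1 k2

omit [Fintype F] [DecidableEq F] in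
theorem SO2.eq_of_vecMul_eq (hF : (2 : F) ≠ 0) {h h' : SO2 F} {x : Fin 2 → F} (hx : x ≠ 0)
    (hh : Matrix.vecMul x h.1 = Matrix.vecMul x h'.1) : h = h' := by
  have e := SO2.entries h
  have e' := SO2.entries h'
  have h0 := congrFun hh 0
  have h1 := congrFun hh 1
  simp only [Matrix.vecMul, dotProduct, Fin.sum_univ_two, e.1, e'.1, e.2.1, e'.2.1] at h0 h1
  obtain ⟨k1, k2⟩ := rotation_unique e.2.2 e'.2.2 (x := x 1) (y := x 0)
    (fun h => hx (by ext i; fin_cases i; exacts [h.2, h.1])) hF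
    (by linear_combination h1) (by linear_combination h0)
  exact SO2.ext_of_entries k1 k2

/-- The number of points of `E` that the rigid motion `k` carries into `E`. -/
def motionDegree (E : Finset (Fin 2 → F)) (k : RigidMotion F) : ℕ :=
  #{x ∈ E | k.apply x ∈ E}

/-- The variance of the number of points of `E` that a random rigid motion carries into `E`. -/
theorem sum_motionDegree_sub_sq_le (hF : ringChar F ≠ 2) (E : Finset (Fin 2 → F)) :
    ∑ k : RigidMotion F, ((motionDegree E k : ℝ) - (#E : ℝ) ^ 2 / (Fintype.card F : ℝ) ^ 2) ^ 2
      ≤ (Fintype.card F : ℝ) ^ 2 * (#E : ℝ) ^ 2 := by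
  obtain ⟨ψ, hψ⟩ := exists_addChar_ne_one F
  have h2 : (2 : F) ≠ 0 := Ring.two_ne_zero hF
  have hq : (0 : ℝ) < Fintype.card F := by exact_mod_cast Fintype.card_pos
  set f : (Fin 2 → F) → ℂ := fun x => if x ∈ E then 1 else 0 with hf
  let μ : SO2 F → (Fin 2 → F) → ℕ := fun h z => #{x ∈ E | z + Matrix.mulVec h.1 x ∈ E}
  have hμ : ∀ h z, (μ h z : ℂ) = ∑ x, f x * f (z + Matrix.mulVec h.1 x) := by
    intro h z
    simp only [μ]
    rw [← filter_univ_mem E, filter_filter, ← sum_boole]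
    refine sum_congr rfl fun y _ => ?_
    simp only [hf, ite_and, filter_univ_mem]
    split_ifs <;> simp
  -- For a fixed rotation the count is a correlation of E with its rotated copy, as a function of
  -- the translation.
  have hfourier : ∀ h ξ, planeFourier ψ (fun z => (μ h z : ℂ)) ξ
      = planeFourier ψ f ξ * (starRingEnd ℂ) (planeFourier ψ f (Matrix.vecMul ξ h.1)) := by
    intro h ξ
    simp only [hμ]
    unfold planeFourier
    rw [map_sum, mul_comm, sum_mul_sum]
    simp only [sum_mul]
    rw [sum_comm]
    refine sum_congr rfl fun x _ => ?_
    refine Fintype.sum_equiv (Equiv.addRight (Matrix.mulVec h.1 x)) _ _ fun z => ?_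
    have hfx : (starRingEnd ℂ) (f x) = f x := by
      simp only [hf]
      split_ifs <;> simp
    rw [Equiv.coe_addRight, map_mul, hfx, ← AddChar.map_neg_eq_conj, mul_mul_mul_comm,
      ← AddChar.map_add_eq_mul, dotProduct_add, Matrix.dotProduct_mulVec]
    congr 2
    ring
  have hsum : ∀ h, ∑ z, (μ h z : ℂ) = (#E : ℂ) ^ 2 := by
    intro h
    rw [← planeFourier_zero ψ, hfourier, Matrix.zero_vecMul, planeFourier_zero]
    simp [hf, sq]
  have hvar : ∀ h, (Fintype.card F : ℝ) ^ 2 * ∑ z, ((μ h z : ℝ)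
      - (#E : ℝ) ^ 2 / (Fintype.card F : ℝ) ^ 2) ^ 2 = ∑ ξ ∈ univ.erase 0,
        ‖planeFourier ψ f ξ‖ ^ 2 * ‖planeFourier ψ f (Matrix.vecMul ξ h.1)‖ ^ 2 := by
    intro h
    have hv := card_sq_mul_variance hψ (fun z => (μ h z : ℂ))
    rw [hsum] at hv
    have hcast : ∀ z, ‖(μ h z : ℂ) - (#E : ℂ) ^ 2 / (Fintype.card F : ℂ) ^ 2‖ ^ 2
        = ((μ h z : ℝ) - (#E : ℝ) ^ 2 / (Fintype.card F : ℝ) ^ 2) ^ 2 := by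
      intro z
      rw [← sq_abs (_ - _ : ℝ), ← Real.norm_eq_abs, ← Complex.norm_real]
      push_cast
      rfl
    simp only [hcast] at hv
    rw [hv]
    refine sum_congr rfl fun ξ _ => ?_
    rw [hfourier, norm_mul, RCLike.norm_conj, mul_pow]
  have hP := sum_norm_sq_planeFourier_indicator hψ E
  rw [← hf] at hP
  have hsplit : ∑ k : RigidMotion F,
      ((motionDegree E k : ℝ) - (#E : ℝ) ^ 2 / (Fintype.card F : ℝ) ^ 2) ^ 2
      = ∑ h : SO2 F, ∑ z, ((μ h z : ℝ) - (#E : ℝ) ^ 2 / (Fintype.card F : ℝ) ^ 2) ^ 2 := by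
    rw [sum_comm, ← Fintype.sum_prod_type']
    exact Fintype.sum_equiv (SemidirectProduct.equivProd.trans
      (Equiv.prodCongr Multiplicative.toAdd (Equiv.refl _))) _ _ fun k => rfl
  rw [hsplit]
  refine le_of_mul_le_mul_left ?_ (pow_pos hq 2)
  rw [mul_sum]
  simp only [hvar]
  rw [sum_comm]
  calc ∑ ξ ∈ univ.erase 0, ∑ h : SO2 F,
        ‖planeFourier ψ f ξ‖ ^ 2 * ‖planeFourier ψ f (Matrix.vecMul ξ h.1)‖ ^ 2
      ≤ ∑ ξ ∈ univ.erase 0, ‖planeFourier ψ f ξ‖ ^ 2 * ((Fintype.card F : ℝ) ^ 2 * #E) := by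
        refine sum_le_sum fun ξ hξ => ?_
        rw [← mul_sum, ← hP]
        refine mul_le_mul_of_nonneg_left ?_ (sq_nonneg _)
        -- For ξ ≠ 0 distinct rotations give distinct frequencies, so the sum over rotations is at
        -- most the whole Parseval sum.
        rw [← sum_image (f := fun ξ => ‖planeFourier ψ f ξ‖ ^ 2)
          (g := fun h : SO2 F => Matrix.vecMul ξ h.1)
          (fun h _ h' _ hh => SO2.eq_of_vecMul_eq h2 (ne_of_mem_erase hξ) hh)]
        exact sum_le_sum_of_subset_of_nonneg (subset_univ _) fun _ _ _ => sq_nonneg _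
    _ ≤ ∑ ξ, ‖planeFourier ψ f ξ‖ ^ 2 * ((Fintype.card F : ℝ) ^ 2 * #E) :=
        sum_le_sum_of_subset_of_nonneg (erase_subset _ _) fun _ _ _ => by positivity
    _ = _ := by
        rw [← sum_mul, hP]
        ring

end PlaneCounting

/-! ### Multiplicative energy and the product set. -/

section Energy

open Finset

theorem sum_card_fiber_mul_card_fiber {α β γ : Type*} [Fintype γ] [DecidableEq γ] (S : Finset α)
    (T : Finset β) (f : α → γ) (g : β → γ) :
    ∑ k, #{a ∈ S | f a = k} * #{b ∈ T | g b = k} = #{p ∈ S ×ˢ T | f p.1 = g p.2} := by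
  rw [card_eq_sum_card_fiberwise (f := fun p : α × β => f p.1) (t := univ)
    (fun _ _ => mem_coe.2 (mem_univ _))]
  refine sum_congr rfl fun k _ => ?_
  rw [← card_product]
  congr 1
  ext p
  simp only [mem_product, mem_filter]
  constructor
  · rintro ⟨⟨h1, rfl⟩, h3, h4⟩
    exact ⟨⟨⟨h1, h3⟩, h4.symm⟩, rfl⟩
  · rintro ⟨⟨⟨h1, h3⟩, h4⟩, rfl⟩
    exact ⟨⟨h1, rfl⟩, h3, h4.symm⟩

variable {G : Type*} [Group G] [Fintype G] [DecidableEq G]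

/-- The number of representations of `k` as `g'⁻¹ g` with `g, g' ∈ X`. -/
def quotientCount (X : Finset G) (k : G) : ℕ := #{p ∈ X ×ˢ X | p.2⁻¹ * p.1 = k}

theorem sum_quotientCount (X : Finset G) : ∑ k, quotientCount X k = #X ^ 2 := by
  rw [sq, ← card_product]
  exact (card_eq_sum_card_fiberwise fun _ _ => mem_coe.2 (mem_univ _)).symm

/-- The equation ab = a'b' reads a'⁻¹a = b'b⁻¹, so the energy is a correlation of left and right
quotient counts. These have the same second moment, and 2xy ≤ x² + y² leaves only the left
quotients. -/
theorem card_pow_four_le_card_mul_sum_sq (X : Finset G) :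
    #X ^ 4 ≤ #(X * X) * ∑ k, quotientCount X k ^ 2 := by
  have h := le_card_mul_mul_mulEnergy X X
  rw [← pow_add] at h
  refine h.trans (Nat.mul_le_mul_left _ ?_)
  set μ : G → ℕ := fun k => #{p ∈ X ×ˢ X | p.2 * p.1⁻¹ = k} with hμ
  have h1 : X.mulEnergy X = ∑ k, quotientCount X k * μ k := by
    simp only [quotientCount, hμ]
    rw [sum_card_fiber_mul_card_fiber, mulEnergy]
    congr 1
    refine filter_congr fun p _ => ?_
    rw [inv_mul_eq_iff_eq_mul, ← mul_assoc, eq_mul_inv_iff_mul_eq]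
  have h2 : ∑ k, μ k ^ 2 = ∑ k, quotientCount X k ^ 2 := by
    simp only [quotientCount, hμ, sq]
    rw [sum_card_fiber_mul_card_fiber, sum_card_fiber_mul_card_fiber]
    refine card_nbij' (fun p => ((p.1.2, p.2.2), (p.1.1, p.2.1)))
      (fun p => ((p.2.1, p.1.1), (p.2.2, p.1.2))) ?_ ?_ (fun _ _ => rfl) (fun _ _ => rfl)
    · rintro ⟨⟨b₁, b₂⟩, c₁, c₂⟩ h
      simp only [coe_filter, mem_product, Set.mem_ofPred_eq] at h ⊢
      refine ⟨⟨⟨h.1.1.2, h.1.2.2⟩, h.1.1.1, h.1.2.1⟩, ?_⟩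
      rw [mul_inv_eq_iff_eq_mul.1 h.2]
      group
    · rintro ⟨⟨b₁, b₂⟩, c₁, c₂⟩ h
      simp only [coe_filter, mem_product, Set.mem_ofPred_eq] at h ⊢
      refine ⟨⟨⟨h.1.2.1, h.1.1.1⟩, h.1.2.2, h.1.1.2⟩, ?_⟩
      rw [inv_mul_eq_iff_eq_mul.1 h.2]
      group
  have h3 : 2 * X.mulEnergy X ≤ 2 * ∑ k, quotientCount X k ^ 2 := by
    rw [two_mul (∑ k, _)]
    nth_rw 2 [← h2]
    rw [h1, mul_sum, ← sum_add_distrib]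
    refine sum_le_sum fun k _ => ?_
    rw [← mul_assoc]
    exact two_mul_le_add_sq _ _
  omega

end Energy

/-! ### Rigid motions as segments of E. -/

section RigidMotions

open Finset

variable {F : Type*} [Field F]

theorem RigidMotion.mul_apply (g h : RigidMotion F) (x : Fin 2 → F) :
    (g * h).apply x = g.apply (h.apply x) := by
  unfold RigidMotion.apply
  rw [Matrix.mulVec_add, Matrix.mulVec_mulVec, ← add_assoc]
  rfl

theorem RigidMotion.one_apply (x : Fin 2 → F) : (1 : RigidMotion F).apply x = x := by
  change 0 + Matrix.mulVec (1 : Matrix (Fin 2) (Fin 2) F) x = x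
  rw [Matrix.one_mulVec, zero_add]

theorem RigidMotion.inv_apply_apply (g : RigidMotion F) (x : Fin 2 → F) :
    g⁻¹.apply (g.apply x) = x := by
  rw [← RigidMotion.mul_apply, inv_mul_cancel, RigidMotion.one_apply]

theorem RigidMotion.apply_inv_apply (g : RigidMotion F) (x : Fin 2 → F) :
    g.apply (g⁻¹.apply x) = x := by
  rw [← RigidMotion.mul_apply, mul_inv_cancel, RigidMotion.one_apply]

theorem RigidMotion.apply_sub_apply (g : RigidMotion F) (x y : Fin 2 → F) :
    g.apply x - g.apply y = Matrix.mulVec g.right.1 (x - y) := by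
  unfold RigidMotion.apply
  rw [Matrix.mulVec_sub]
  abel

theorem RigidMotion.planeNorm_apply_sub (g : RigidMotion F) (x y : Fin 2 → F) :
    planeNorm (g.apply x - g.apply y) = planeNorm (x - y) := by
  obtain ⟨h1, h2, h3⟩ := SO2.entries g.right
  rw [RigidMotion.apply_sub_apply]
  set w := x - y
  simp only [planeNorm, Matrix.mulVec, dotProduct, Fin.sum_univ_two, h1, h2]
  linear_combination (w 0 ^ 2 + w 1 ^ 2) * h3

theorem RigidMotion.eq_of_apply_eq (hF : (2 : F) ≠ 0) {g h : RigidMotion F} {x y : Fin 2 → F}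
    (hxy : x ≠ y) (hx : g.apply x = h.apply x) (hy : g.apply y = h.apply y) : g = h := by
  have hr : g.right = h.right := by
    refine SO2.eq_of_mulVec_eq hF (sub_ne_zero.2 hxy) ?_
    rw [← RigidMotion.apply_sub_apply, ← RigidMotion.apply_sub_apply, hx, hy]
  refine SemidirectProduct.ext ?_ hr
  unfold RigidMotion.apply at hx
  rw [hr] at hx
  exact Multiplicative.toAdd.injective (add_right_cancel hx)

theorem ne_of_planeNorm_sub_ne_zero {x y : Fin 2 → F} (h : planeNorm (x - y) ≠ 0) : x ≠ y := by
  rintro rfl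
  exact h (by simp [planeNorm])

/-- Segments of equal nonzero length are congruent. -/
theorem RigidMotion.exists_apply_eq {x y u v : Fin 2 → F} {t : F} (ht : t ≠ 0)
    (hxy : planeNorm (x - y) = t) (huv : planeNorm (u - v) = t) :
    ∃ g : RigidMotion F, g.apply x = u ∧ g.apply y = v := by
  -- In complex notation a + ib is the quotient (u - v)/(x - y), with denominator cleared by the
  -- norm t.
  set a := ((x 0 - y 0) * (u 0 - v 0) + (x 1 - y 1) * (u 1 - v 1)) / t with ha
  set b := ((x 0 - y 0) * (u 1 - v 1) - (x 1 - y 1) * (u 0 - v 0)) / t with hb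
  simp only [planeNorm, Pi.sub_apply] at hxy huv
  have hab : a ^ 2 + b ^ 2 = 1 := by
    rw [ha, hb]
    field_simp
    linear_combination ((u 0 - v 0) ^ 2 + (u 1 - v 1) ^ 2) * hxy + t * huv
  have hmem : !![a, -b; b, a] ∈ Matrix.specialOrthogonalGroup (Fin 2) F := by
    rw [Matrix.mem_specialOrthogonalGroup_fin_two_iff]
    simp [hab]
  have hw : Matrix.mulVec !![a, -b; b, a] (x - y) = u - v := by
    have h0 : a * (x 0 - y 0) - b * (x 1 - y 1) = u 0 - v 0 := by
      rw [ha, hb]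
      field_simp
      linear_combination (u 0 - v 0) * hxy
    have h1 : b * (x 0 - y 0) + a * (x 1 - y 1) = u 1 - v 1 := by
      rw [ha, hb]
      field_simp
      linear_combination (u 1 - v 1) * hxy
    ext i
    fin_cases i
    · simp [Matrix.mulVec, dotProduct, Fin.sum_univ_two]
      linear_combination h0
    · simp [Matrix.mulVec, dotProduct, Fin.sum_univ_two]
      linear_combination h1
  let g : RigidMotion F :=
    ⟨Multiplicative.ofAdd (u - Matrix.mulVec !![a, -b; b, a] x), ⟨_, hmem⟩⟩
  have hgx : g.apply x = u := sub_add_cancel _ _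
  refine ⟨g, hgx, ?_⟩
  have h := RigidMotion.apply_sub_apply g x y
  rw [hgx] at h
  have h' : u - g.apply y = u - v := h.trans hw
  exact sub_right_injective h'

variable [Fintype F]

open Classical in
/-- The motions in `X_t` for which the preimage of `u` satisfies `A`. -/
noncomputable def segmentMotionsOn (E : Finset (Fin 2 → F)) (u v : Fin 2 → F)
    (A : (Fin 2 → F) → Prop) : Finset (RigidMotion F) :=
  {g | g⁻¹.apply u ∈ E ∧ g⁻¹.apply v ∈ E ∧ A (g⁻¹.apply u)}

theorem mem_segmentMotionsOn {E : Finset (Fin 2 → F)} {u v : Fin 2 → F}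
    {A : (Fin 2 → F) → Prop} {g : RigidMotion F} :
    g ∈ segmentMotionsOn E u v A ↔ g⁻¹.apply u ∈ E ∧ g⁻¹.apply v ∈ E ∧ A (g⁻¹.apply u) := by
  simp [segmentMotionsOn]

theorem segmentMotions_eq {E : Finset (Fin 2 → F)} {t : F} {u v : Fin 2 → F}
    (huv : planeNorm (u - v) = t) :
    segmentMotions E t u v = ↑(segmentMotionsOn E u v fun _ => True) := by
  ext g
  rw [mem_coe, mem_segmentMotionsOn]
  constructor
  · rintro ⟨x, hx, y, hy, -, rfl, rfl⟩
    simp only [RigidMotion.inv_apply_apply]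
    exact ⟨hx, hy, trivial⟩
  · rintro ⟨hx, hy, -⟩
    exact ⟨_, hx, _, hy, by rw [RigidMotion.planeNorm_apply_sub, huv], g.apply_inv_apply u,
      g.apply_inv_apply v⟩

variable [DecidableEq F]

/-- The bijection sends g to the segment (g⁻¹u, g⁻¹v); a motion is determined by the images of two
distinct points, and congruence of segments gives surjectivity. -/
theorem card_segmentMotionsOn (hF : (2 : F) ≠ 0) {E : Finset (Fin 2 → F)} {t : F} (ht : t ≠ 0)
    {u v : Fin 2 → F} (huv : planeNorm (u - v) = t) (A : (Fin 2 → F) → Prop) [DecidablePred A] :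
    #(segmentMotionsOn E u v A) = ∑ x ∈ E with A x, circleDegree E t x := by
  unfold circleDegree
  rw [← card_sigma]
  have huv' : u ≠ v := ne_of_planeNorm_sub_ne_zero (by rwa [huv])
  refine card_bij (fun g _ => ⟨g⁻¹.apply u, g⁻¹.apply v⟩) ?_ ?_ ?_
  · intro g hg
    obtain ⟨h1, h2, h3⟩ := mem_segmentMotionsOn.1 hg
    simp only [mem_sigma, mem_filter]
    exact ⟨⟨h1, h3⟩, h2, by rw [RigidMotion.planeNorm_apply_sub, huv]⟩
  · intro g _ g' _ h
    simp only [Sigma.mk.injEq, heq_eq_eq] at h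
    exact inv_injective (RigidMotion.eq_of_apply_eq hF huv' h.1 h.2)
  · rintro ⟨x, y⟩ h
    simp only [mem_sigma, mem_filter] at h
    obtain ⟨g, rfl, rfl⟩ := RigidMotion.exists_apply_eq ht h.2.2 huv
    refine ⟨g, ?_, ?_⟩
    · simp only [mem_segmentMotionsOn, RigidMotion.inv_apply_apply]
      exact ⟨h.1.1, h.2.1, h.1.2⟩
    · simp only [RigidMotion.inv_apply_apply]

/-- Given k, the pair (g, g') is determined by the segment (x, y) of g. Since kx = g'⁻¹u, there are
at most `motionDegree E k` choices of x, each with at most D choices of y. -/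
theorem quotientCount_segmentMotionsOn_le [DecidableEq (RigidMotion F)] (hF : (2 : F) ≠ 0)
    {E : Finset (Fin 2 → F)} {t : F} (ht : t ≠ 0) {u v : Fin 2 → F} (huv : planeNorm (u - v) = t)
    {D : ℝ} (hD : 0 ≤ D) (k : RigidMotion F) :
    (quotientCount (segmentMotionsOn E u v fun x => (circleDegree E t x : ℝ) ≤ D) k : ℝ)
      ≤ D * motionDegree E k := by
  classical
  have huv' : u ≠ v := ne_of_planeNorm_sub_ne_zero (by rwa [huv])
  have h : quotientCount (segmentMotionsOn E u v fun x => (circleDegree E t x : ℝ) ≤ D) k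
      ≤ ∑ x ∈ E with (k.apply x ∈ E ∧ (circleDegree E t x : ℝ) ≤ D), circleDegree E t x := by
    conv_rhs => unfold circleDegree
    rw [← card_sigma]
    unfold quotientCount
    refine card_le_card_of_injOn (fun p => ⟨p.1⁻¹.apply u, p.1⁻¹.apply v⟩) ?_ ?_
    · rintro ⟨g, g'⟩ hp
      simp only [coe_filter, mem_product, mem_segmentMotionsOn, Set.mem_ofPred_eq] at hp
      obtain ⟨⟨⟨h1, h2, h3⟩, h4, -, -⟩, rfl⟩ := hp
      simp only [coe_sigma, Set.mem_sigma_iff, mem_coe, mem_filter]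
      refine ⟨⟨h1, ?_, h3⟩, h2, by rw [RigidMotion.planeNorm_apply_sub, huv]⟩
      rwa [RigidMotion.mul_apply, RigidMotion.apply_inv_apply]
    · rintro ⟨g, g'⟩ hp ⟨h, h'⟩ hp' heq
      simp only [coe_filter, mem_product, Set.mem_ofPred_eq] at hp hp'
      simp only [Sigma.mk.injEq, heq_eq_eq] at heq
      have hgh : g = h := inv_injective (RigidMotion.eq_of_apply_eq hF huv' heq.1 heq.2)
      have := hp.2.trans hp'.2.symm
      rw [hgh] at this
      exact Prod.ext hgh (inv_injective (mul_right_cancel this))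
  calc (quotientCount (segmentMotionsOn E u v fun x => (circleDegree E t x : ℝ) ≤ D) k : ℝ)
      ≤ ∑ x ∈ E with (k.apply x ∈ E ∧ (circleDegree E t x : ℝ) ≤ D), (circleDegree E t x : ℝ) := by
        exact_mod_cast h
    _ ≤ ∑ x ∈ E with (k.apply x ∈ E ∧ (circleDegree E t x : ℝ) ≤ D), D :=
        sum_le_sum fun x hx => (mem_filter.1 hx).2.2
    _ = #{x ∈ E | k.apply x ∈ E ∧ (circleDegree E t x : ℝ) ≤ D} * D := by
        rw [sum_const, nsmul_eq_mul]
    _ ≤ D * motionDegree E k := by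
        rw [mul_comm]
        refine mul_le_mul_of_nonneg_left ?_ hD
        rw [motionDegree]
        have hsub : {x ∈ E | k.apply x ∈ E ∧ (circleDegree E t x : ℝ) ≤ D} ⊆ {x ∈ E | k.apply x ∈ E} :=
          fun x hx => mem_filter.2 ⟨(mem_filter.1 hx).1, (mem_filter.1 hx).2.1⟩
        exact_mod_cast card_le_card hsub

end RigidMotions

/-! ### The energy bound and growth of the product set. -/

section Growth

open Finset

/-- In ν² ≤ Dνi one splits i = m + (i - m) and absorbs half of ν² by the arithmetic–geometric mean
inequality. -/
theorem sum_sq_le_of_le_mul {ι : Type*} [Fintype ι] {ν i : ι → ℝ} (hν : ∀ k, 0 ≤ ν k)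
    {D m B : ℝ} (h : ∀ k, ν k ≤ D * i k) (hB : ∑ k, (i k - m) ^ 2 ≤ B) :
    ∑ k, ν k ^ 2 ≤ 2 * (D * m * ∑ k, ν k) + D ^ 2 * B := by
  have h1 : ∀ k, ν k ^ 2 ≤ 2 * (D * m * ν k) + D ^ 2 * (i k - m) ^ 2 := by
    intro k
    have : ν k ^ 2 ≤ ν k * (D * i k) := by
      rw [sq]
      exact mul_le_mul_of_nonneg_left (h k) (hν k)
    nlinarith [sq_nonneg (ν k - D * (i k - m))]
  calc ∑ k, ν k ^ 2 ≤ ∑ k, (2 * (D * m * ν k) + D ^ 2 * (i k - m) ^ 2) :=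
        sum_le_sum fun k _ => h1 k
    _ = 2 * (D * m * ∑ k, ν k) + D ^ 2 * ∑ k, (i k - m) ^ 2 := by
        rw [sum_add_distrib, ← mul_sum, ← mul_sum, ← mul_sum]
    _ ≤ _ := by gcongr

/-- The dominant energy term decides which member of the minimum appears: the mean term gives qN,
the variance term N⁴/q⁴. The constant is 288 = 2⁴ · 18. -/
theorem min_le_of_pow_four_le {q N X P : ℝ} (hq : 0 < q) (hN : 0 < N) (hP : 0 ≤ P)
    (hX : N ^ 2 / (2 * q) ≤ X)
    (h : X ^ 4 ≤ P * (6 * N ^ 3 / q ^ 3 * X ^ 2 + 9 * N ^ 4)) :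
    1 / 288 * min (q * N) (N ^ 4 / q ^ 4) ≤ P := by
  have hX0 : 0 < X := lt_of_lt_of_le (by positivity) hX
  have hX2 : (N ^ 2 / (2 * q)) ^ 2 ≤ X ^ 2 := pow_le_pow_left₀ (by positivity) hX 2
  have hX4 : (N ^ 2 / (2 * q)) ^ 4 ≤ X ^ 4 := pow_le_pow_left₀ (by positivity) hX 4
  rcases le_total (9 * N ^ 4) (6 * N ^ 3 / q ^ 3 * X ^ 2) with hc | hc
  · have h1 : X ^ 2 * X ^ 2 ≤ (P * (12 * N ^ 3 / q ^ 3)) * X ^ 2 := by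
      calc X ^ 2 * X ^ 2 = X ^ 4 := by ring
        _ ≤ P * (6 * N ^ 3 / q ^ 3 * X ^ 2 + 6 * N ^ 3 / q ^ 3 * X ^ 2) :=
          h.trans (by gcongr)
        _ = _ := by ring
    have h2 := le_of_mul_le_mul_right h1 (by positivity)
    have h3 := hX2.trans h2
    have h4 : q * N / 48 ≤ P := by
      have e1 : (N ^ 2 / (2 * q)) ^ 2 = (q * N / 48) * (12 * N ^ 3 / q ^ 3) := by
        field_simp
        norm_num
      rw [e1] at h3
      exact le_of_mul_le_mul_right h3 (by positivity)
    have h5 := min_le_left (q * N) (N ^ 4 / q ^ 4)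
    have : 0 < q * N := by positivity
    linarith
  · have h1 : X ^ 4 ≤ P * (18 * N ^ 4) := h.trans (by
      refine mul_le_mul_of_nonneg_left ?_ hP
      linarith)
    have h3 := hX4.trans h1
    have h4 : N ^ 4 / q ^ 4 / 288 ≤ P := by
      have e1 : (N ^ 2 / (2 * q)) ^ 4 = (N ^ 4 / q ^ 4 / 288) * (18 * N ^ 4) := by
        field_simp
        norm_num
      rw [e1] at h3
      exact le_of_mul_le_mul_right h3 (by positivity)
    have h5 := min_le_right (q * N) (N ^ 4 / q ^ 4)
    linarith

variable {F : Type*} [Field F] [Fintype F]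

/-- Size and growth of `X_t` for a set `E` with at least `12 q ^ (3 / 2)` points. -/
theorem card_segmentMotionsOn_mul_self (hF : ringChar F ≠ 2) [DecidableEq (RigidMotion F)]
    {E : Finset (Fin 2 → F)}
    (hE : 12 * (Fintype.card F * √(Fintype.card F)) ≤ (#E : ℝ)) {t : F} (ht : t ≠ 0)
    {u v : Fin 2 → F} (huv : planeNorm (u - v) = t) :
    (#(segmentMotionsOn E u v fun _ => True) : ℝ) ≤ 2 * ((#E : ℝ) ^ 2 / Fintype.card F) ∧
    1 / 288 * min ((Fintype.card F : ℝ) * #E) ((#E : ℝ) ^ 4 / (Fintype.card F : ℝ) ^ 4)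
      ≤ #(segmentMotionsOn E u v (fun _ => True) * segmentMotionsOn E u v fun _ => True) := by
  classical
  have h2 : (2 : F) ≠ 0 := Ring.two_ne_zero hF
  have hq3 : (3 : ℝ) ≤ Fintype.card F := by
    have := FiniteField.odd_card_of_char_ne_two hF
    have := Fintype.one_lt_card (α := F)
    exact_mod_cast (by omega : 3 ≤ Fintype.card F)
  have hdeg := sum_circleDegree_sub_sq_le hF ht E
  have hmot := sum_motionDegree_sub_sq_le hF E
  have hcirc := abs_le.1 (abs_card_circle_sub_le hF ht)
  set q : ℝ := (Fintype.card F : ℝ)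
  set s : ℝ := (#{x : Fin 2 → F | planeNorm x = t} : ℝ)
  set N : ℝ := (#E : ℝ)
  set m : ℝ := N * s / q ^ 2 with hm
  have hq0 : 0 < q := by linarith
  have hs0 : 0 < √q := Real.sqrt_pos.2 hq0
  have hN0 : 0 < N := lt_of_lt_of_le (by positivity) hE
  -- A circle has q ± 1 points, hence between 2q/3 and 4q/3 for q ≥ 3.
  have hm1 : 2 / 3 * (N / q) ≤ m := by
    rw [hm, le_div_iff₀ (by positivity)]
    have : 2 / 3 * (N / q) * q ^ 2 = N * (2 / 3 * q) := by field_simp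
    rw [this]
    exact mul_le_mul_of_nonneg_left (by linarith) hN0.le
  have hm2 : m ≤ 4 / 3 * (N / q) := by
    rw [hm, div_le_iff₀ (by positivity)]
    have : 4 / 3 * (N / q) * q ^ 2 = N * (4 / 3 * q) := by field_simp
    rw [this]
    exact mul_le_mul_of_nonneg_left (by linarith) hN0.le
  -- The 12 makes the mean deviation 2√q at most N/(6q), so 2/3 - 1/6 = 1/2 of N/q is left for the
  -- lower bound.
  have hsqrt : 12 * √q ≤ N / q := by
    rw [le_div_iff₀ hq0]
    linarith
  have hNq : 0 < N / q := by positivity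
  have hm0 : 0 < m := by linarith
  have hdev : ∑ x ∈ E, |(circleDegree E t x : ℝ) - m| ≤ N * (2 * √q) := by
    refine abs_le_of_sq_le_sq' ?_ (by positivity) |>.2
    refine (sq_sum_le_card_mul_sum_sq).trans ?_
    simp only [sq_abs]
    calc N * ∑ x ∈ E, ((circleDegree E t x : ℝ) - m) ^ 2
        ≤ N * ∑ x, ((circleDegree E t x : ℝ) - m) ^ 2 := by
          refine mul_le_mul_of_nonneg_left ?_ hN0.le
          exact sum_le_sum_of_subset_of_nonneg (subset_univ _) fun _ _ _ => sq_nonneg _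
      _ ≤ N * (4 * q * N) := mul_le_mul_of_nonneg_left hdeg hN0.le
      _ = (N * (2 * √q)) ^ 2 := by
          rw [mul_pow, mul_pow, Real.sq_sqrt hq0.le]
          ring
  have hupper : (#(segmentMotionsOn E u v fun _ => True) : ℝ) ≤ 2 * (N ^ 2 / q) := by
    rw [card_segmentMotionsOn h2 ht huv]
    push_cast
    rw [filter_true]
    calc ∑ x ∈ E, (circleDegree E t x : ℝ)
        ≤ ∑ x ∈ E, (m + |(circleDegree E t x : ℝ) - m|) :=
          sum_le_sum fun x _ => by linarith [le_abs_self ((circleDegree E t x : ℝ) - m)]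
      _ = N * m + ∑ x ∈ E, |(circleDegree E t x : ℝ) - m| := by
          rw [sum_add_distrib, sum_const, nsmul_eq_mul]
      _ ≤ N * (2 * (N / q)) := by
          rw [show N * (2 * (N / q)) = N * (2 * (N / q) - 2 * √q) + N * (2 * √q) by ring]
          refine add_le_add (mul_le_mul_of_nonneg_left ?_ hN0.le) hdev
          linarith
      _ = 2 * (N ^ 2 / q) := by ring
  refine ⟨hupper, ?_⟩
  -- The cutoff 2m suits the bound m - |d - m|, which is at most d always and negative when d > 2m;
  -- discarded points therefore cost nothing in `hlower`.
  set X := segmentMotionsOn E u v fun x => (circleDegree E t x : ℝ) ≤ 2 * m with hX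
  have hlower : N ^ 2 / (2 * q) ≤ (#X : ℝ) := by
    rw [hX, card_segmentMotionsOn h2 ht huv]
    push_cast
    rw [sum_filter]
    calc N ^ 2 / (2 * q) = N * (1 / 2 * (N / q)) := by
          field_simp
      _ ≤ N * (m - 2 * √q) := mul_le_mul_of_nonneg_left (by linarith) hN0.le
      _ ≤ N * m - ∑ x ∈ E, |(circleDegree E t x : ℝ) - m| := by linarith
      _ = ∑ x ∈ E, (m - |(circleDegree E t x : ℝ) - m|) := by
          rw [sum_sub_distrib, sum_const, nsmul_eq_mul]
      _ ≤ _ := by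
          refine sum_le_sum fun x _ => ?_
          split_ifs with hx
          · linarith [neg_abs_le ((circleDegree E t x : ℝ) - m)]
          · linarith [le_abs_self ((circleDegree E t x : ℝ) - m)]
  have hsub : X ⊆ segmentMotionsOn E u v fun _ => True := by
    intro g hg
    have := mem_segmentMotionsOn.1 hg
    exact mem_segmentMotionsOn.2 ⟨this.1, this.2.1, trivial⟩
  have hXX : (#(X * X) : ℝ) ≤
      #(segmentMotionsOn E u v (fun _ => True) * segmentMotionsOn E u v fun _ => True) := by
    exact_mod_cast card_le_card (mul_subset_mul hsub hsub)
  refine le_trans ?_ hXX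
  have henergy : ∑ k, (quotientCount X k : ℝ) ^ 2 ≤ 6 * N ^ 3 / q ^ 3 * (#X : ℝ) ^ 2 + 9 * N ^ 4 := by
    have h := sum_sq_le_of_le_mul (ν := fun k => (quotientCount X k : ℝ))
      (i := fun k => (motionDegree E k : ℝ)) (fun k => Nat.cast_nonneg _) (D := 2 * m)
      (fun k => quotientCount_segmentMotionsOn_le h2 ht huv (by positivity) k) hmot
    have hsum : ∑ k, (quotientCount X k : ℝ) = (#X : ℝ) ^ 2 := by
      exact_mod_cast sum_quotientCount X
    rw [hsum] at h
    have h2m : 2 * m ≤ 3 * (N / q) := by linarith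
    have h2m0 : 0 ≤ 2 * m := by positivity
    generalize 2 * m = D at h h2m h2m0
    refine h.trans (add_le_add ?_ ?_)
    · calc 2 * (D * (N ^ 2 / q ^ 2) * (#X : ℝ) ^ 2)
          ≤ 2 * (3 * (N / q) * (N ^ 2 / q ^ 2) * (#X : ℝ) ^ 2) := by
            gcongr
        _ = _ := by field_simp; ring
    · calc D ^ 2 * (q ^ 2 * N ^ 2) ≤ (3 * (N / q)) ^ 2 * (q ^ 2 * N ^ 2) := by
            gcongr
        _ = _ := by field_simp; ring
  have hfour : (#X : ℝ) ^ 4 ≤ #(X * X) * ∑ k, (quotientCount X k : ℝ) ^ 2 := by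
    exact_mod_cast card_pow_four_le_card_mul_sum_sq X
  exact min_le_of_pow_four_le hq0 hN0 (Nat.cast_nonneg _) hlower
    (hfour.trans (mul_le_mul_of_nonneg_left henergy (Nat.cast_nonneg _)))

end Growth

/-! ### Conversion to powers of q and of |X_t|. -/

section Exponents

variable {q N K P α : ℝ}

/-- Relative to N²/q, the quantities qN and N⁴/q⁴ are larger by q^(2-α) and q^(2α-3). -/
theorem rpow_min_mul_le (hq : 1 ≤ q) (hN : N = q ^ α) :
    q ^ min (2 - α) (2 * α - 3) * (N ^ 2 / q) ≤ min (q * N) (N ^ 4 / q ^ 4) := by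
  have hq0 : 0 < q := by linarith
  have hN0 : 0 < N := hN ▸ Real.rpow_pos_of_pos hq0 α
  refine le_min ?_ ?_
  · calc q ^ min (2 - α) (2 * α - 3) * (N ^ 2 / q)
        ≤ q ^ (2 - α) * (N ^ 2 / q) := by
          gcongr
          exact min_le_left _ _
      _ = q * N := by
          rw [Real.rpow_sub hq0, ← hN, Real.rpow_two]
          field_simp
  · calc q ^ min (2 - α) (2 * α - 3) * (N ^ 2 / q)
        ≤ q ^ (2 * α - 3) * (N ^ 2 / q) := by
          gcongr
          exact min_le_right _ _
      _ = N ^ 4 / q ^ 4 := by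
          rw [Real.rpow_sub hq0, mul_comm 2 α, Real.rpow_mul hq0.le, ← hN, Real.rpow_two,
            show (3 : ℝ) = (3 : ℕ) by norm_num, Real.rpow_natCast]
          field_simp

theorem exponent_mem (hα : 3 / 2 < α) (hα' : α < 2) :
    0 ≤ min (2 - α) (2 * α - 3) / (2 * α - 1) ∧ min (2 - α) (2 * α - 3) / (2 * α - 1) ≤ 1 := by
  have h1 : 0 < 2 * α - 1 := by linarith
  have h2 : 0 ≤ min (2 - α) (2 * α - 3) := le_min (by linarith) (by linarith)
  refine ⟨div_nonneg h2 h1.le, (div_le_one h1).2 ((min_le_right _ _).trans (by linarith))⟩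

/-- As N²/q = q^(2α-1), the exponent δ is the one with (N²/q)^δ = q^m; the factor 2 dominates 2^δ
with δ ≤ 1. -/
theorem rpow_one_add_le (hq : 1 ≤ q) (hα : 3 / 2 < α) (hα' : α < 2) (hN : N = q ^ α) (hK : 0 < K)
    (hKN : K ≤ 2 * (N ^ 2 / q)) :
    K ^ (1 + min (2 - α) (2 * α - 3) / (2 * α - 1))
      ≤ 2 * (q ^ min (2 - α) (2 * α - 3) * K) := by
  have hq0 : 0 < q := by linarith
  obtain ⟨h0, h1⟩ := exponent_mem hα hα'
  have hpos : 2 * α - 1 ≠ 0 := by linarith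
  have hbase : N ^ 2 / q = q ^ (2 * α - 1) := by
    rw [Real.rpow_sub hq0, mul_comm 2 α, Real.rpow_mul hq0.le, ← hN, Real.rpow_two, Real.rpow_one]
  set m := min (2 - α) (2 * α - 3)
  calc K ^ (1 + m / (2 * α - 1)) = K * K ^ (m / (2 * α - 1)) := by
        rw [Real.rpow_add hK, Real.rpow_one]
    _ ≤ K * (2 * (N ^ 2 / q)) ^ (m / (2 * α - 1)) := by gcongr
    _ = K * (2 ^ (m / (2 * α - 1)) * q ^ m) := by
        rw [hbase, Real.mul_rpow zero_le_two (Real.rpow_nonneg hq0.le _), ← Real.rpow_mul hq0.le,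
          mul_div_cancel₀ _ hpos]
    _ ≤ K * (2 * q ^ m) := by
        gcongr
        calc (2 : ℝ) ^ (m / (2 * α - 1)) ≤ 2 ^ (1 : ℝ) :=
              Real.rpow_le_rpow_of_exponent_le one_le_two h1
          _ = 2 := Real.rpow_one 2
    _ = _ := by ring

end Exponents

/-! ### Large and small q together. -/

theorem one_mem_segmentMotions {F : Type*} [Field F] {E : Finset (Fin 2 → F)} {t : F}
    {u v : Fin 2 → F} (hu : u ∈ E) (hv : v ∈ E) (huv : planeNorm (u - v) = t) :
    1 ∈ segmentMotions E t u v :=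
  ⟨u, hu, v, hv, huv, RigidMotion.one_apply u, RigidMotion.one_apply v⟩

theorem ncard_segmentMotions_le {F : Type*} [Field F] [Fintype F] (hF : ringChar F ≠ 2)
    {E : Finset (Fin 2 → F)} {t : F} (ht : t ≠ 0) {u v : Fin 2 → F} (huv : planeNorm (u - v) = t) :
    (segmentMotions E t u v).ncard ≤ E.card ^ 2 := by
  classical
  rw [segmentMotions_eq huv, Set.ncard_coe_finset,
    card_segmentMotionsOn (Ring.two_ne_zero hF) ht huv, Finset.filter_true, sq, ← smul_eq_mul]
  exact Finset.sum_le_card_nsmul _ _ _ fun x _ => Finset.card_filter_le _ _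

theorem theorem9 :
    ∃ c₀ : ℝ, 0 < c₀ ∧ ∀ ε : ℝ, 0 < ε → ∃ c₁ : ℝ, 0 < c₁ ∧ ∃ q₀ : ℕ,
      ∀ (F : Type*) [Field F] [Fintype F], ringChar F ≠ 2 →
      ∀ (α : ℝ), 3 / 2 + ε ≤ α → α < 2 →
      ∀ (E : Finset (Fin 2 → F)), (E.card : ℝ) = (Fintype.card F : ℝ) ^ α →
      ∀ (t : F), t ≠ 0 →
      ∀ u₀ ∈ E, ∀ v₀ ∈ E, planeNorm (u₀ - v₀) = t →
      ∃ c : ℝ, c₁ ≤ c ∧ (q₀ ≤ Fintype.card F → c₀ ≤ c) ∧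
        c * ((segmentMotions E t u₀ v₀).ncard : ℝ) ^ (1 + min (2 - α) (2 * α - 3) / (2 * α - 1))
          ≤ ((segmentMotions E t u₀ v₀ * segmentMotions E t u₀ v₀).ncard : ℝ) ∧
        c * ((Fintype.card F : ℝ) ^ min (2 - α) (2 * α - 3) *
            ((segmentMotions E t u₀ v₀).ncard : ℝ))
          ≤ ((segmentMotions E t u₀ v₀ * segmentMotions E t u₀ v₀).ncard : ℝ) ∧
        c * min ((Fintype.card F : ℝ) * (E.card : ℝ))
            ((E.card : ℝ) ^ 4 / (Fintype.card F : ℝ) ^ 4)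
          ≤ ((segmentMotions E t u₀ v₀ * segmentMotions E t u₀ v₀).ncard : ℝ) := by
  -- Passing from the minimum to q^m|X_t| and then to |X_t|^(1+δ) loses a factor 2 each time; 4 ·
  -- 288 = 1152 is below 2000.
  refine ⟨1 / 2000, by norm_num, fun ε hε => ?_⟩
  -- Chosen so that q ≥ q₀ gives q^ε ≥ 12, hence |E| ≥ 12 q^(3/2).
  obtain ⟨q₀, hq₀⟩ := exists_nat_ge ((12 : ℝ) ^ ε⁻¹)
  -- For q < q₀ each quantity to be bounded is at most (q₀+1)⁸, because |E| ≤ q² and |X_t| ≤ |E|²;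
  -- nonemptiness of the product set then suffices.
  refine ⟨1 / (2000 * (q₀ + 1 : ℝ) ^ 8), by positivity, q₀, ?_⟩
  intro F _ _ hF α hα hα2 E hE t ht u hu v hv huv
  classical
  have hα' : 3 / 2 < α := by linarith
  obtain ⟨hδ0, hδ1⟩ := exponent_mem hα' hα2
  have hq1 : (1 : ℝ) ≤ Fintype.card F := by exact_mod_cast Fintype.card_pos
  have hK1 : (1 : ℝ) ≤ (segmentMotions E t u v).ncard := by
    have := (Set.ncard_pos (Set.toFinite _)).2 ⟨1, one_mem_segmentMotions hu hv huv⟩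
    exact_mod_cast this
  by_cases hq : q₀ ≤ Fintype.card F
  · have hc : 1 / (2000 * (q₀ + 1 : ℝ) ^ 8) ≤ 1 / 2000 := by
      have : (1 : ℝ) ≤ (q₀ + 1 : ℝ) ^ 8 := one_le_pow₀ (by linarith [(Nat.cast_nonneg q₀ : (0:ℝ) ≤ q₀)])
      exact one_div_le_one_div_of_le (by norm_num) (by linarith)
    refine ⟨1 / 2000, hc, fun _ => le_rfl, ?_⟩
    have hlarge : 12 * (Fintype.card F * √(Fintype.card F)) ≤ (E.card : ℝ) := by
      have hqR : (q₀ : ℝ) ≤ Fintype.card F := by exact_mod_cast hq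
      have hq0 : (0 : ℝ) < Fintype.card F := by linarith
      have h12 : (12 : ℝ) ≤ (Fintype.card F : ℝ) ^ ε := by
        calc (12 : ℝ) = ((12 : ℝ) ^ ε⁻¹) ^ ε := by
              rw [← Real.rpow_mul (by norm_num), inv_mul_cancel₀ hε.ne', Real.rpow_one]
          _ ≤ _ := Real.rpow_le_rpow (by positivity) (hq₀.trans hqR) hε.le
      calc 12 * (Fintype.card F * √(Fintype.card F))
          ≤ (Fintype.card F : ℝ) ^ ε * (Fintype.card F * √(Fintype.card F)) := by gcongr
        _ = (Fintype.card F : ℝ) ^ (ε + (1 + 1 / 2)) := by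
            rw [Real.rpow_add hq0, Real.rpow_add hq0, Real.rpow_one, ← Real.sqrt_eq_rpow]
        _ ≤ (Fintype.card F : ℝ) ^ α := Real.rpow_le_rpow_of_exponent_le hq1 (by linarith)
        _ = _ := hE.symm
    obtain ⟨hupper, hgrowth⟩ := card_segmentMotionsOn_mul_self hF hlarge ht huv
    rw [← Set.ncard_coe_finset, ← segmentMotions_eq huv] at hupper
    have hprod : (segmentMotions E t u v * segmentMotions E t u v).ncard
        = (segmentMotionsOn E u v (fun _ => True) * segmentMotionsOn E u v fun _ => True).card := by
      rw [segmentMotions_eq huv, ← Finset.coe_mul, Set.ncard_coe_finset]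
    rw [← hprod] at hgrowth
    have h1 := rpow_one_add_le hq1 hα' hα2 hE (by linarith) hupper
    have h2 := rpow_min_mul_le hq1 hE
    have hqm : (0 : ℝ) < (Fintype.card F : ℝ) ^ min (2 - α) (2 * α - 3) :=
      Real.rpow_pos_of_pos (by linarith) _
    have h3 := mul_le_mul_of_nonneg_left hupper hqm.le
    have h4 : 0 ≤ min ((Fintype.card F : ℝ) * E.card)
        ((E.card : ℝ) ^ 4 / (Fintype.card F : ℝ) ^ 4) := le_min (by positivity) (by positivity)
    refine ⟨by linarith, by linarith, by linarith⟩
  · refine ⟨_, le_rfl, fun h => absurd h hq, ?_⟩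
    have hP1 : (1 : ℝ) ≤ (segmentMotions E t u v * segmentMotions E t u v).ncard := by
      have := (Set.ncard_pos (Set.toFinite (segmentMotions E t u v * segmentMotions E t u v))).2
        ⟨1 * 1, Set.mul_mem_mul (one_mem_segmentMotions hu hv huv)
          (one_mem_segmentMotions hu hv huv)⟩
      exact_mod_cast this
    have hqq : (Fintype.card F : ℝ) ≤ q₀ + 1 := by exact_mod_cast (by omega)
    set Q : ℝ := (q₀ + 1 : ℝ)
    have hQ1 : 1 ≤ Q := hq1.trans hqq
    have hN : (E.card : ℝ) ≤ Q ^ 2 := by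
      rw [hE]
      calc (Fintype.card F : ℝ) ^ α ≤ (Fintype.card F : ℝ) ^ (2 : ℝ) :=
            Real.rpow_le_rpow_of_exponent_le hq1 hα2.le
        _ = (Fintype.card F : ℝ) ^ 2 := Real.rpow_two _
        _ ≤ Q ^ 2 := by gcongr
    have hK : ((segmentMotions E t u v).ncard : ℝ) ≤ Q ^ 4 := by
      calc ((segmentMotions E t u v).ncard : ℝ) ≤ (E.card : ℝ) ^ 2 := by
            exact_mod_cast ncard_segmentMotions_le hF ht huv
        _ ≤ (Q ^ 2) ^ 2 := by gcongr
        _ = Q ^ 4 := by ring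
    have bound : ∀ x : ℝ, x ≤ Q ^ 8 → 1 / (2000 * Q ^ 8) * x
        ≤ (segmentMotions E t u v * segmentMotions E t u v).ncard := by
      intro x hx
      refine le_trans ?_ hP1
      rw [one_div_mul_eq_div, div_le_one (by positivity)]
      have : 0 < Q ^ 8 := by positivity
      linarith
    refine ⟨bound _ ?_, bound _ ?_, bound _ ?_⟩
    · calc _ ≤ ((segmentMotions E t u v).ncard : ℝ) ^ (2 : ℝ) :=
            Real.rpow_le_rpow_of_exponent_le hK1 (by linarith)
        _ = ((segmentMotions E t u v).ncard : ℝ) ^ 2 := Real.rpow_two _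
        _ ≤ (Q ^ 4) ^ 2 := by gcongr
        _ = Q ^ 8 := by ring
    · calc _ ≤ (Fintype.card F : ℝ) ^ (1 : ℝ) * ((segmentMotions E t u v).ncard : ℝ) := by
            gcongr
            exact (min_le_left _ _).trans (by linarith)
        _ ≤ Q * Q ^ 4 := by
            rw [Real.rpow_one]
            gcongr
        _ = Q ^ 5 := by ring
        _ ≤ Q ^ 8 := pow_le_pow_right₀ hQ1 (by norm_num)
    · calc _ ≤ (Fintype.card F : ℝ) * E.card := min_le_left _ _
        _ ≤ Q * Q ^ 2 := by gcongr
        _ = Q ^ 3 := by ring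
        _ ≤ Q ^ 8 := pow_le_pow_right₀ hQ1 (by norm_num)
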